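/- Let $\sigma, n \ge 0$ be integers and let $P=(P_1,\dots,P_\sigma)$ be a vector of non-negative integers with $P_1+\dots+P_\sigma=n$. The words with Parikh vector $P$ are the words $w$ of length $n$ over the alphabet $\{1,\dots,\sigma\}$ in which each symbol $a$ occurs exactly $P_a$ times. A 2-swap of $w$ by a pair of positions $i<j$ with $w[i]\ne w[j]$ exchanges the symbols at positions $i$ and $j$. The configuration graph $G(P)$ has the words with Parikh vector $P$ as vertices, two words being adjacent when some 2-swap turns one into the other. A Hamiltonian path is a path visiting every vertex exactly once. The model of computation is the unit-cost word RAM (arithmetic $+,-,\cdot,/$ on words, indirect addressing, memory initially zero) in which all numbers and addresses that occur are less than $(n+\sigma+2)^{c}$ for a constant $c$, i.e. words have $O(\log(n+\sigma+2))$ bits. An algorithm \emph{enumerates a Hamiltonian path from $w$ with preprocessing time $T$ and delay $D$} if it halts, if during a first phase of at most $T$ steps it writes out the word $w$, and if it then outputs the successive edges of a Hamiltonian path of $G(P)$ starting at $w$, each edge as the pair $(i,j)$ of the corresponding 2-swap, in such a way that at most $D$ consecutive steps without output occur before the first edge, between two edges, and after the last edge. **Theorem.** (1) There is an algorithm (one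 program for all $\sigma$ and $P$) which, given $\sigma$ and $P$ with $\sigma\le n$ (for instance, any $P$ with all entries positive), enumerates a Hamiltonian path in $G(P)$, starting at some word with Parikh vector $P$, with delay $O(\sigma\log n)$ after $O(n\log n)$ preprocessing. (2) There is also an algorithm (one program for all $\sigma$, $P$ and $w$) which, given any word $w$ with Parikh vector $P$ (together with $\sigma$ and $n$), enumerates a Hamiltonian path in $G(P)$ starting at $w$ with delay $O(\sigma\log n)$ after $O(n\log n)$ preprocessing. Here the implied constants are absolute, and for $n\le 1$ (where $\log n$ is $0$ or undefined) the bounds mean $O(1)$. -/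

import Mathlib

/-! ## Words, 2-swaps and configuration graphs -/

namespace SwapGraph

/-- The Parikh vector of a word of length `n` over the alphabet `Fin σ`: the entry at `a` is the
number of positions that carry the symbol `a`. -/
def parikh {σ n : ℕ} (w : Fin n → Fin σ) : Fin σ → ℕ :=
  fun a => (Finset.univ.filter fun k => w k = a).card

/-- `u` is the 2-swap of `w` by the pair `(i, j)`: `i < j`, the symbols of `w` at `i` and `j`
differ, and `u` arises from `w` by exchanging these two symbols. -/
def IsTwoSwap {σ n : ℕ} (w : Fin n → Fin σ) (i j : Fin n) (u : Fin n → Fin σ) : Prop :=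
  i < j ∧ w i ≠ w j ∧ u = w ∘ Equiv.swap i j

/-- The words (of length `n`) whose Parikh vector is `P`. -/
abbrev ParikhWord {σ : ℕ} (n : ℕ) (P : Fin σ → ℕ) : Type :=
  {w : Fin n → Fin σ // parikh w = P}

theorem IsTwoSwap.symm {σ n : ℕ} {w u : Fin n → Fin σ} {i j : Fin n}
    (h : IsTwoSwap w i j u) : IsTwoSwap u i j w := by
  obtain ⟨hij, hne, rfl⟩ := h
  refine ⟨hij, by simpa using hne.symm, ?_⟩
  funext k
  simp

theorem IsTwoSwap.ne {σ n : ℕ} {w u : Fin n → Fin σ} {i j : Fin n}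
    (h : IsTwoSwap w i j u) : w ≠ u := by
  obtain ⟨_, hne, rfl⟩ := h
  intro h
  exact hne (by simpa using congrFun h i)

/-- The configuration graph `G(P)`: its vertices are the words with Parikh vector `P`, and two
words are adjacent when some 2-swap turns one into the other. -/
def configGraph {σ : ℕ} (n : ℕ) (P : Fin σ → ℕ) : SimpleGraph (ParikhWord n P) where
  Adj w u := ∃ i j : Fin n, IsTwoSwap w.1 i j u.1
  symm := ⟨fun _ _ h => by
    obtain ⟨i, j, h⟩ := h
    exact ⟨i, j, h.symm⟩⟩
  loopless := ⟨fun _ h => by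
    obtain ⟨i, j, h⟩ := h
    exact h.ne rfl⟩

/-- The list `l` records the walk, edge by edge: its `k`-th entry is the pair of positions
(counted from 1) of the 2-swap that leads from the `k`-th vertex to the next one. -/
def Records {σ n : ℕ} {P : Fin σ → ℕ} :
    {u v : ParikhWord n P} → (configGraph n P).Walk u v → List (ℕ × ℕ) → Prop
  | _, _, .nil, l => l = []
  | u, _, .cons (v := x) _ q, l =>
      ∃ (i j : Fin n) (l' : List (ℕ × ℕ)),
        IsTwoSwap u.1 i j x.1 ∧ l = (i.1 + 1, j.1 + 1) :: l' ∧ Records q l'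

/-- A word written out symbol by symbol, as pairs (position, symbol), both counted from 1. -/
def spell {σ n : ℕ} (w : Fin n → Fin σ) : List (ℕ × ℕ) :=
  List.ofFn fun k => (k.1 + 1, (w k).1 + 1)

/-! ## The machine model: a word RAM with unit-cost operations

A machine has registers, which a program addresses by fixed numbers (so that a program uses only
finitely many of them), and a random access memory. Programs are structured (sequencing,
branching, loops). Every elementary operation takes one step. The machine words are the numbers
below a bound `B`; a run may never produce a number or address that does not fit in a word. -/

/-- The content of the registers and of the memory. -/
structure State where
  reg : ℕ → ℕ
  mem : ℕ → ℕ

/-- Expressions: constants, registers, memory cells at a computed address, and arithmetic. -/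
inductive Expr where
  | const (k : ℕ)
  | var (r : ℕ)
  | load (a : Expr)
  | add (a b : Expr)
  | sub (a b : Expr)
  | mul (a b : Expr)
  | div (a b : Expr)

/-- The value of an expression (subtraction is truncated at 0, division rounds down). -/
def Expr.eval (s : State) : Expr → ℕ
  | .const k => k
  | .var r => s.reg r
  | .load a => s.mem (a.eval s)
  | .add a b => a.eval s + b.eval s
  | .sub a b => a.eval s - b.eval s
  | .mul a b => a.eval s * b.eval s
  | .div a b => a.eval s / b.eval s

/-- The number of steps that evaluating an expression takes: one for each of its nodes. -/
def Expr.cost : Expr → ℕ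
  | .const _ => 1
  | .var _ => 1
  | .load a => a.cost + 1
  | .add a b => a.cost + b.cost + 1
  | .sub a b => a.cost + b.cost + 1
  | .mul a b => a.cost + b.cost + 1
  | .div a b => a.cost + b.cost + 1

/-- All numbers that occur while the expression is evaluated (its own value, intermediate values
and addresses) fit in a machine word, that is, they are less than `B`. -/
def Expr.Fits (B : ℕ) (s : State) : Expr → Prop
  | .const k => k < B
  | .var r => s.reg r < B
  | .load a => a.Fits B s ∧ s.mem (a.eval s) < B
  | .add a b => a.Fits B s ∧ b.Fits B s ∧ a.eval s + b.eval s < B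
  | .sub a b => a.Fits B s ∧ b.Fits B s
  | .mul a b => a.Fits B s ∧ b.Fits B s ∧ a.eval s * b.eval s < B
  | .div a b => a.Fits B s ∧ b.Fits B s

/-- Programs. -/
inductive Prog where
  /-- do nothing -/
  | skip
  /-- register `r` := `e` -/
  | assign (r : ℕ) (e : Expr)
  /-- memory cell at address `a` := `e` -/
  | store (a e : Expr)
  /-- output the pair of words `(a, b)` -/
  | out (a b : Expr)
  /-- first `p`, then `q` -/
  | seq (p q : Prog)
  /-- if `e ≠ 0` then `p` else `q` -/
  | ite (e : Expr) (p q : Prog)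
  /-- while `e ≠ 0` do `p` -/
  | loop (e : Expr) (p : Prog)

/-- What happens in the steps of a run, in order: `none` is a step without output,
`some (a, b)` is a step that outputs `(a, b)`. The length of a trace is the running time. -/
abbrev Trace : Type := List (Option (ℕ × ℕ))

/-- `k` steps without output. -/
def quiet (k : ℕ) : Trace := List.replicate k none

/-- `Exec B p s t s'`: on a machine whose words are the numbers below `B`, the program `p` started
in state `s` halts in state `s'`, no number ever exceeds the word size, and `t` is the trace. -/
inductive Exec (B : ℕ) : Prog → State → Trace → State → Prop where
  | skip (s : State) : Exec B .skip s (quiet 1) s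
  | assign (r : ℕ) (e : Expr) (s : State) (he : e.Fits B s) :
      Exec B (.assign r e) s (quiet (e.cost + 1)) ⟨Function.update s.reg r (e.eval s), s.mem⟩
  | store (a e : Expr) (s : State) (ha : a.Fits B s) (he : e.Fits B s) :
      Exec B (.store a e) s (quiet (a.cost + e.cost + 1))
        ⟨s.reg, Function.update s.mem (a.eval s) (e.eval s)⟩
  | out (a b : Expr) (s : State) (ha : a.Fits B s) (hb : b.Fits B s) :
      Exec B (.out a b) s (quiet (a.cost + b.cost) ++ [some (a.eval s, b.eval s)]) s
  | seq {p q : Prog} {s s' s'' : State} {t t' : Trace}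
      (hp : Exec B p s t s') (hq : Exec B q s' t' s'') :
      Exec B (.seq p q) s (t ++ t') s''
  | iteTrue {e : Expr} {p q : Prog} {s s' : State} {t : Trace}
      (hf : e.Fits B s) (he : e.eval s ≠ 0) (hp : Exec B p s t s') :
      Exec B (.ite e p q) s (quiet (e.cost + 1) ++ t) s'
  | iteFalse {e : Expr} {p q : Prog} {s s' : State} {t : Trace}
      (hf : e.Fits B s) (he : e.eval s = 0) (hq : Exec B q s t s') :
      Exec B (.ite e p q) s (quiet (e.cost + 1) ++ t) s'
  | loopDone {e : Expr} {p : Prog} {s : State}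
      (hf : e.Fits B s) (he : e.eval s = 0) :
      Exec B (.loop e p) s (quiet (e.cost + 1)) s
  | loopStep {e : Expr} {p : Prog} {s s' s'' : State} {t t' : Trace}
      (hf : e.Fits B s) (he : e.eval s ≠ 0)
      (hp : Exec B p s t s') (hl : Exec B (.loop e p) s' t' s'') :
      Exec B (.loop e p) s (quiet (e.cost + 1) ++ t ++ t') s''

/-- The machine is deterministic: trace and final state are determined by the program and the
initial state. -/
theorem Exec.deterministic {B : ℕ} {p : Prog} {s : State} {t₁ t₂ : Trace} {s₁ s₂ : State}
    (h₁ : Exec B p s t₁ s₁) (h₂ : Exec B p s t₂ s₂) : t₁ = t₂ ∧ s₁ = s₂ := by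
  induction h₁ generalizing t₂ s₂ with
  | skip s => cases h₂; exact ⟨rfl, rfl⟩
  | assign r e s he => cases h₂; exact ⟨rfl, rfl⟩
  | store a e s ha he => cases h₂; exact ⟨rfl, rfl⟩
  | out a b s ha hb => cases h₂; exact ⟨rfl, rfl⟩
  | seq hp hq ihp ihq =>
    cases h₂ with
    | seq hp' hq' =>
      obtain ⟨rfl, rfl⟩ := ihp hp'
      obtain ⟨rfl, rfl⟩ := ihq hq'
      exact ⟨rfl, rfl⟩
  | iteTrue hf he hp ihp =>
    cases h₂ with
    | iteTrue _ _ hp' =>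
      obtain ⟨rfl, rfl⟩ := ihp hp'
      exact ⟨rfl, rfl⟩
    | iteFalse _ he' _ => exact absurd he' he
  | iteFalse hf he hq ihq =>
    cases h₂ with
    | iteTrue _ he' _ => exact absurd he he'
    | iteFalse _ _ hq' =>
      obtain ⟨rfl, rfl⟩ := ihq hq'
      exact ⟨rfl, rfl⟩
  | loopDone hf he =>
    cases h₂ with
    | loopDone _ _ => exact ⟨rfl, rfl⟩
    | loopStep _ he' _ _ => exact absurd he he'
  | loopStep hf he hp hl ihp ihl =>
    cases h₂ with
    | loopDone _ he' => exact absurd he' he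
    | loopStep _ _ hp' hl' =>
      obtain ⟨rfl, rfl⟩ := ihp hp'
      obtain ⟨rfl, rfl⟩ := ihl hl'
      exact ⟨rfl, rfl⟩

/-- The outputs made during a trace, in order. -/
def outputs (t : Trace) : List (ℕ × ℕ) := t.reduceOption

/-- The delay in the trace is at most `D`: no stretch of consecutive steps without output (before
the first output, between two outputs, or after the last one) is longer than `D`. -/
def DelayLE (t : Trace) (D : ℕ) : Prop :=
  ∀ q : Trace, q <:+: t → (∀ x ∈ q, x = none) → q.length ≤ D

/-! ## Inputs and the enumeration task -/

/-- The input consisting of a Parikh vector: register 0 holds the size `σ` of the alphabet, the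
memory cells `0, …, σ - 1` hold the entries of the vector, all else is 0. -/
def parikhInput {σ : ℕ} (P : Fin σ → ℕ) : State where
  reg r := if r = 0 then σ else 0
  mem k := if h : k < σ then P ⟨k, h⟩ else 0

/-- The input consisting of a word: register 0 holds the size `σ` of the alphabet, register 1 the
length `n` of the word, the memory cells `0, …, n - 1` hold its symbols (counted from 1), all else
is 0. -/
def wordInput {σ n : ℕ} (w : Fin n → Fin σ) : State where
  reg r := if r = 0 then σ else if r = 1 then n else 0
  mem k := if h : k < n then (w ⟨k, h⟩).1 + 1 else 0

/-- On a machine with word bound `B`, the program `p` started in state `s` writes out the word `w`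
during a preprocessing phase of at most `T` steps, then outputs the edges (as 2-swaps) of a
Hamiltonian path in `G(P)` that starts at `w`, with delay at most `D`, and halts. -/
def EnumeratesFrom {σ n : ℕ} {P : Fin σ → ℕ} (p : Prog) (B T D : ℕ) (s : State)
    (w : ParikhWord n P) : Prop :=
  ∃ (pre main : Trace) (s' : State),
    Exec B p s (pre ++ main) s' ∧
    outputs pre = spell w.1 ∧
    pre.length ≤ T ∧
    (∃ (v : ParikhWord n P) (q : (configGraph n P).Walk w v),
      q.IsHamiltonian ∧ Records q (outputs main)) ∧
    DelayLE main D

end SwapGraph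

/-!
The Hamiltonian path comes from a recursion that works from every starting word. To run through all
rearrangements of the first `m + 1` symbols of a word, run through the rearrangements of the first
`m` symbols; then, for every other symbol `b` among the first `m + 1`, fetch `b` to position `m` by
one 2-swap with an occurrence below `m`, and again run through the rearrangements of the first `m`
symbols. It does not matter in which arrangement a recursive call begins or ends, nor which
occurrence of `b` is fetched: the symbol of a word at position `m` determines the one recursive call
that visits it, and by induction this call visits it exactly once (`enum_level`, `enum_prefix`,
`exists_steps`, `exists_hamiltonian`).

To bound the delay the recursion is unrolled. Level `m` chooses the symbol at position `m`. A step
is made by the lowest level that is not exhausted. After it all lower levels start afresh, and a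
level is of interest only from the first position `f` on at which the symbol differs from that at
position 0. As in Ehrlich's loopless algorithms, focus pointers store for each maximal run of
exhausted levels the first level above it, so the next level to make a step is found at the focus
pointer of `f`. A level in progress remembers only the symbol with which it began: that symbol comes
first, and the others follow in increasing order.

On the machine, each symbol has a tournament tree over the positions, which shows its first
occurrence at the root. A scan of the roots yields `f`, and a second scan yields the next symbol of
the level, and whether it is the last one; both take `O(σ)` steps (`findChange_spec`,
`chooseNext_spec`). A 2-swap changes four leaves, at a cost of `O(log n)` steps each
(`updateTree_spec`). The trees are built in `O(n log n)` steps by inserting the positions one by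
one into memory that is initially zero, so symbols that do not occur cost nothing. A word with a
given Parikh vector, the sorted one, is written down in `O(σ + n)` steps (`expand_spec`).
-/

namespace SwapGraph

open Function

/-! ### Rearrangements of an initial segment -/

/-- `u` is obtained from `w` by rearranging the symbols at the positions below `m`. -/
def SameBelow (m : ℕ) (w u : ℕ → ℕ) : Prop :=
  (∀ k, m ≤ k → u k = w k) ∧
    ∀ a, ((Finset.range m).filter (u · = a)).card = ((Finset.range m).filter (w · = a)).card

theorem SameBelow.refl (m : ℕ) (w : ℕ → ℕ) : SameBelow m w w := ⟨fun _ _ => rfl, fun _ => rfl⟩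

theorem SameBelow.symm {m : ℕ} {w u : ℕ → ℕ} (h : SameBelow m w u) : SameBelow m u w :=
  ⟨fun k hk => (h.1 k hk).symm, fun a => (h.2 a).symm⟩

theorem SameBelow.trans {m : ℕ} {w u v : ℕ → ℕ} (h : SameBelow m w u) (h' : SameBelow m u v) :
    SameBelow m w v :=
  ⟨fun k hk => (h'.1 k hk).trans (h.1 k hk), fun a => (h'.2 a).trans (h.2 a)⟩

theorem SameBelow.exists_eq {m : ℕ} {w u : ℕ → ℕ} (h : SameBelow m w u) {k : ℕ} (hk : k < m) :
    ∃ k' < m, w k' = u k := by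
  have h1 : 0 < ((Finset.range m).filter (u · = u k)).card :=
    Finset.card_pos.2 ⟨k, by simp [hk]⟩
  rw [h.2, Finset.card_pos] at h1
  obtain ⟨k', h2⟩ := h1
  simp only [Finset.mem_filter, Finset.mem_range] at h2
  exact ⟨k', h2⟩

theorem SameBelow.image_eq {m : ℕ} {w u : ℕ → ℕ} (h : SameBelow m w u) :
    (Finset.range m).image u = (Finset.range m).image w := by
  ext a
  simp only [Finset.mem_image, Finset.mem_range]
  constructor
  · rintro ⟨k, hk, rfl⟩
    exact h.exists_eq hk
  · rintro ⟨k, hk, rfl⟩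
    exact h.symm.exists_eq hk

theorem card_filter_range_succ (m : ℕ) (w : ℕ → ℕ) (a : ℕ) :
    ((Finset.range (m + 1)).filter (w · = a)).card =
      ((Finset.range m).filter (w · = a)).card + if w m = a then 1 else 0 := by
  rw [Finset.range_add_one, Finset.filter_insert]
  split_ifs
  · rw [Finset.card_insert_of_notMem (by simp)]
  · rfl

/-- The rearrangements of the first `m` symbols are the rearrangements of the first `m + 1` symbols
that keep the symbol at position `m`. -/
theorem sameBelow_succ_iff {m : ℕ} {w u : ℕ → ℕ} :
    SameBelow m w u ↔ SameBelow (m + 1) w u ∧ u m = w m := by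
  constructor
  · intro h
    have hm := h.1 m le_rfl
    refine ⟨⟨fun k hk => h.1 k (by omega), fun a => ?_⟩, hm⟩
    rw [card_filter_range_succ, card_filter_range_succ, h.2 a, hm]
  · rintro ⟨h, hm⟩
    refine ⟨fun k hk => ?_, fun a => ?_⟩
    · rcases hk.eq_or_lt with rfl | hk
      · exact hm
      · exact h.1 k hk
    · have := h.2 a
      rw [card_filter_range_succ, card_filter_range_succ, hm] at this
      omega

theorem sameBelow_swap {m i : ℕ} (w : ℕ → ℕ) (hi : i < m) :
    SameBelow (m + 1) w (w ∘ Equiv.swap i m) := by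
  refine ⟨fun k hk => ?_, fun a => ?_⟩
  · simp [Equiv.swap_apply_of_ne_of_ne (show k ≠ i by omega) (show k ≠ m by omega)]
  · refine Finset.card_bij (fun k _ => Equiv.swap i m k) ?_ ?_ ?_
    · intro k hk
      simp only [Finset.mem_filter, Finset.mem_range, comp_apply] at hk ⊢
      refine ⟨?_, hk.2⟩
      rw [Equiv.swap_apply_def]
      split_ifs <;> omega
    · intro k _ k' _ h
      exact (Equiv.swap i m).injective h
    · intro k hk
      simp only [Finset.mem_filter, Finset.mem_range] at hk
      refine ⟨Equiv.swap i m k, ?_, by simp⟩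
      simp only [Finset.mem_filter, Finset.mem_range, comp_apply, Equiv.swap_apply_self, hk.2,
        and_true]
      rw [Equiv.swap_apply_def]
      split_ifs <;> omega

/-- `f` is the first position at which the word `w` of length `n` differs from its first symbol;
for a constant word it is `n`. -/
structure FirstChange (n : ℕ) (w : ℕ → ℕ) (f : ℕ) : Prop where
  pos : 1 ≤ f
  le : f ≤ n
  const : ∀ k < f, w k = w 0
  ne : f < n → w f ≠ w 0

theorem FirstChange.unique {n : ℕ} {w : ℕ → ℕ} {f f' : ℕ} (h : FirstChange n w f)
    (h' : FirstChange n w f') : f = f' := by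
  by_contra hne
  rcases lt_or_gt_of_ne hne with hlt | hlt
  · exact h.ne (hlt.trans_le h'.le) (h'.const f hlt)
  · exact h'.ne (hlt.trans_le h.le) (h.const f' hlt)

theorem FirstChange.exists {n : ℕ} (hn : 1 ≤ n) (w : ℕ → ℕ) : ∃ f, FirstChange n w f := by
  by_cases h : ∃ f, f < n ∧ w f ≠ w 0
  · classical
    refine ⟨Nat.find h, ?_, (Nat.find_spec h).1.le, ?_, fun _ => (Nat.find_spec h).2⟩
    · by_contra h0
      have h0 : Nat.find h = 0 := by omega
      exact (Nat.find_spec h).2 (by rw [h0])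
    · intro k hk
      have h1 := Nat.find_min h hk
      have h2 := (Nat.find_spec h).1
      by_contra h3
      exact h1 ⟨hk.trans h2, h3⟩
  · push Not at h
    exact ⟨n, hn, le_rfl, h, fun h => absurd h (lt_irrefl n)⟩

theorem FirstChange.le_of_ne {n : ℕ} {w : ℕ → ℕ} {f i m : ℕ} (h : FirstChange n w f)
    (hi : i < m) (hne : w i ≠ w m) : f ≤ m := by
  by_contra hlt
  exact hne ((h.const i (by omega)).trans (h.const m (by omega)).symm)

/-- An initial segment of equal symbols has no other rearrangement. -/
theorem sameBelow_const_iff {n m f : ℕ} {w u : ℕ → ℕ} (h : FirstChange n w f) (hm : m ≤ f) :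
    SameBelow m w u ↔ u = w := by
  constructor
  · intro hu
    funext k
    by_cases hk : k < m
    · obtain ⟨k', hk', he⟩ := hu.exists_eq hk
      rw [← he, h.const k' (by omega), h.const k (by omega)]
    · exact hu.1 k (by omega)
  · rintro rfl
    exact SameBelow.refl _ _

/-! ### The enumeration -/

/-- The state of the enumeration. `word` is the current word. Level `m` runs through the symbols
that occur at positions `0, …, m`, putting each of them at position `m`; `start m` is the symbol
with which a level in progress has begun, and `0` for a level not in progress. `jump` holds the
focus pointers: at the lower end of a run of exhausted levels it points to the first level above
the run, everywhere else it is the identity. -/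
structure Config where
  word : ℕ → ℕ
  start : ℕ → ℕ
  jump : ℕ → ℕ

/-- The symbol with which level `m` has begun, when `t` is its entry in `start`. -/
def startSym (w : ℕ → ℕ) (t m : ℕ) : ℕ := if t = 0 then w m else t

/-- The symbols that level `m` has still to put at position `m`: the symbol with which it began
comes first, the others follow in increasing order. -/
def cand (w : ℕ → ℕ) (t m : ℕ) : Finset ℕ :=
  ((Finset.range m).image w).filter fun b => (if t = 0 then 0 else w m) < b ∧ b ≠ startSym w t m

/-- The configuration after level `m`, found at the focus pointer of `f`, has exchanged the
symbols at `i` and `m`, bringing the symbol `b` to position `m`. If `b` was the last symbol of the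
level, the level becomes exhausted and joins the run of exhausted levels above it. -/
def Config.advance (c : Config) (f m i b : ℕ) : Config where
  word := c.word ∘ Equiv.swap i m
  start := update c.start m
    (if cand c.word (c.start m) m = {b} then 0 else startSym c.word (c.start m) m)
  jump := if cand c.word (c.start m) m = {b} then
      update (update (update c.jump f f) m (c.jump (m + 1))) (m + 1) (m + 1)
    else update c.jump f f

/-- One step of the enumeration: the lowest level that is not exhausted advances to its next
symbol `b`, which is fetched from its first occurrence `i`. -/
inductive Step (n : ℕ) (c : Config) : ℕ → ℕ → Config → Prop
  | mk {f m i b : ℕ} (hf : FirstChange n c.word f) (hj : c.jump f = m) (hm : m < n)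
      (hb : IsLeast (cand c.word (c.start m) m : Set ℕ) b)
      (hi : IsLeast {k | c.word k = b} i) : Step n c i m (c.advance f m i b)

/-- A run of the enumeration together with the list of pairs of positions it exchanges. -/
inductive Steps (n : ℕ) : Config → List (ℕ × ℕ) → Config → Prop
  | nil (c : Config) : Steps n c [] c
  | cons {c c' c'' : Config} {i m : ℕ} {l : List (ℕ × ℕ)} (h : Step n c i m c')
      (hl : Steps n c' l c'') : Steps n c ((i, m) :: l) c''

/-- The words that arise from `w` by successive exchanges (without `w` itself). -/
def trail : (ℕ → ℕ) → List (ℕ × ℕ) → List (ℕ → ℕ)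
  | _, [] => []
  | w, (i, j) :: l => (w ∘ Equiv.swap i j) :: trail (w ∘ Equiv.swap i j) l

theorem Steps.append {n : ℕ} {c c' c'' : Config} {l l' : List (ℕ × ℕ)} (h : Steps n c l c')
    (h' : Steps n c' l' c'') : Steps n c (l ++ l') c'' := by
  induction h with
  | nil c => exact h'
  | cons h _ ih => exact .cons h (ih h')

theorem Step.word_eq {n : ℕ} {c c' : Config} {i m : ℕ} (h : Step n c i m c') :
    c'.word = c.word ∘ Equiv.swap i m := by
  cases h
  rfl

theorem Steps.trail_append {n : ℕ} {c c' : Config} {l : List (ℕ × ℕ)} (h : Steps n c l c')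
    (l' : List (ℕ × ℕ)) : trail c.word (l ++ l') = trail c.word l ++ trail c'.word l' := by
  induction h with
  | nil c => rfl
  | cons h _ ih => simp only [List.cons_append, trail, ← h.word_eq, ih]

theorem Steps.word_mem {n : ℕ} {c c' : Config} {l : List (ℕ × ℕ)} (h : Steps n c l c') :
    c'.word ∈ c.word :: trail c.word l := by
  induction h with
  | nil c => simp
  | cons h _ ih =>
    rw [trail, ← h.word_eq]
    exact List.mem_cons_of_mem _ ih

/-- The candidates of level `m` do not depend on the arrangement of the symbols below `m`, so they
survive the steps of the lower levels. -/
theorem cand_congr {w u : ℕ → ℕ} {m : ℕ} (h : SameBelow m w u) (t : ℕ) :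
    cand u t m = cand w t m := by
  unfold cand startSym
  rw [h.image_eq, h.1 m le_rfl]

theorem mem_cand {w : ℕ → ℕ} {t m b : ℕ} : b ∈ cand w t m ↔
    (∃ k < m, w k = b) ∧ (if t = 0 then 0 else w m) < b ∧ b ≠ startSym w t m := by
  simp [cand]

theorem ne_of_mem_cand {w : ℕ → ℕ} {t m b : ℕ} (h : b ∈ cand w t m) : b ≠ w m := by
  rw [mem_cand, startSym] at h
  split_ifs at h with h0
  · exact h.2.2
  · omega

/-- Bringing the least candidate to position `m` leaves the other candidates. -/
theorem cand_swap {w : ℕ → ℕ} {t m i b : ℕ}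
    (hb : IsLeast (cand w t m : Set ℕ) b) (hi : w i = b) (him : i < m) (hst : startSym w t m ≠ 0) :
    cand (w ∘ Equiv.swap i m) (startSym w t m) m = (cand w t m).erase b := by
  have hm : (w ∘ Equiv.swap i m) m = b := by simp [hi]
  ext b'
  rw [Finset.mem_erase, mem_cand, hm, if_neg hst]
  have hs : startSym (w ∘ Equiv.swap i m) (startSym w t m) m = startSym w t m := by
    rw [startSym, if_neg hst]
  rw [hs]
  have key : b' ≠ b → b' ≠ w m → ((∃ k < m, (w ∘ Equiv.swap i m) k = b') ↔ ∃ k < m, w k = b') := by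
    intro h1 h2
    constructor
    · rintro ⟨k, hk, he⟩
      by_cases hki : k = i
      · subst hki
        simp at he
        exact absurd he.symm h2
      · rw [comp_apply, Equiv.swap_apply_of_ne_of_ne hki (by omega)] at he
        exact ⟨k, hk, he⟩
    · rintro ⟨k, hk, he⟩
      have hki : k ≠ i := by
        rintro rfl
        exact h1 (he.symm.trans hi)
      exact ⟨k, hk, by rw [comp_apply, Equiv.swap_apply_of_ne_of_ne hki (by omega), he]⟩
  have hbc := mem_cand.1 hb.1
  constructor
  · rintro ⟨h1, h2, h3⟩
    have h4 : b' ≠ w m := by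
      unfold startSym at h3
      split_ifs at h3 with h0
      · exact h3
      · rw [if_neg h0] at hbc
        omega
    refine ⟨h2.ne', mem_cand.2 ⟨(key h2.ne' h4).1 h1, hbc.2.1.trans h2, h3⟩⟩
  · rintro ⟨h1, h2⟩
    have h3 := ne_of_mem_cand h2
    have h4 : b ≤ b' := hb.2 h2
    have h5 := mem_cand.1 h2
    exact ⟨(key h1 h3).2 h5.1, by omega, h5.2.2⟩

/-! ### The enumeration visits every word once -/

/-- The conclusion of `enum_prefix` for the levels below `m`. -/
def EnumeratesBelow (n m : ℕ) : Prop :=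
  ∀ (c : Config) (f : ℕ), (∀ k < n, c.word k ≠ 0) → (∀ k < m, c.start k = 0) →
    (∀ k < m, c.jump k = k) → FirstChange n c.word f →
    ∃ (l : List (ℕ × ℕ)) (c' : Config) (f' : ℕ), Steps n c l c' ∧
      (c.word :: trail c.word l).Nodup ∧
      (∀ u, u ∈ c.word :: trail c.word l ↔ SameBelow m c.word u) ∧
      c'.start = c.start ∧ FirstChange n c'.word f' ∧
      ((m ≤ f ∧ c' = c) ∨
        (f < m ∧ f' < m ∧ c'.jump = update (update c.jump f' (c.jump m)) m m))

theorem SameBelow.ne_zero {n m : ℕ} {w u : ℕ → ℕ} (h : SameBelow m w u) (hmn : m ≤ n)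
    (hw : ∀ k < n, w k ≠ 0) : ∀ k < n, u k ≠ 0 := by
  intro k hk
  by_cases hkm : k < m
  · obtain ⟨k', hk', he⟩ := h.exists_eq hkm
    exact he ▸ hw k' (by omega)
  · exact h.1 k (by omega) ▸ hw k hk

/-- Once level `m` is the lowest level that is not exhausted, the levels up to `m` run through all
rearrangements that put one of the remaining candidates of level `m` at position `m`. -/
theorem enum_level {n m : ℕ} (hmn : m < n) (ih : EnumeratesBelow n m) (r : ℕ) :
    ∀ (c : Config) (f : ℕ), (∀ k < n, c.word k ≠ 0) → (∀ k < m, c.start k = 0) →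
      FirstChange n c.word f → f ≤ m → c.jump f = m → (∀ k ≤ m, update c.jump f f k = k) →
      (cand c.word (c.start m) m).card = r + 1 →
      ∃ (l : List (ℕ × ℕ)) (c' : Config) (f' : ℕ), Steps n c l c' ∧
        (trail c.word l).Nodup ∧
        (∀ u, u ∈ trail c.word l ↔
          SameBelow (m + 1) c.word u ∧ u m ∈ cand c.word (c.start m) m) ∧
        c'.start = update c.start m 0 ∧ FirstChange n c'.word f' ∧ f' ≤ m ∧
        c'.jump = update (update (update c.jump f f) f' (c.jump (m + 1))) (m + 1) (m + 1) := by
  induction r with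
  | zero =>
    intro c f hw hs hf hfm hj hJ hcard
    obtain ⟨b, hb⟩ := Finset.card_eq_one.1 hcard
    have hbl : IsLeast (cand c.word (c.start m) m : Set ℕ) b := by rw [hb]; simp
    obtain ⟨⟨k, hk, hkb⟩, -⟩ := mem_cand.1 hbl.1
    obtain ⟨i, hi⟩ : ∃ i, IsLeast {k | c.word k = b} i :=
      ⟨sInf {k | c.word k = b}, Nat.sInf_mem (s := {k | c.word k = b}) ⟨k, hkb⟩,
        fun _ h => Nat.sInf_le h⟩
    have hib : c.word i = b := hi.1
    have him : i < m := (hi.2 hkb).trans_lt hk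
    have hstep := Step.mk hf hj hmn hbl hi
    set c₁ := c.advance f m i b with hc₁
    have hw₁ : c₁.word = c.word ∘ Equiv.swap i m := rfl
    have hs₁ : c₁.start = update c.start m 0 := by simp [hc₁, Config.advance, hb]
    have hj₁ : c₁.jump =
        update (update (update c.jump f f) m (c.jump (m + 1))) (m + 1) (m + 1) := by
      simp [hc₁, Config.advance, hb]
    have hsame : SameBelow (m + 1) c.word c₁.word := sameBelow_swap _ him
    have hm₁ : c₁.word m = b := by simp [hw₁, hib]
    obtain ⟨f₁, hf₁⟩ := FirstChange.exists (show 1 ≤ n by omega) c₁.word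
    have hf₁m : f₁ ≤ m := by
      refine hf₁.le_of_ne him ?_
      rw [hm₁, hw₁]
      simpa using (ne_of_mem_cand hbl.1).symm
    have hJ₁ : ∀ k < m, c₁.jump k = k := by
      intro k hk
      rw [hj₁, update_of_ne (by omega), update_of_ne (by omega)]
      exact hJ k hk.le
    obtain ⟨l, c', f', hl, hnd, hmem, hs', hf', hcase⟩ := ih c₁ f₁
      (hsame.ne_zero hmn hw) (by
        intro k hk
        rw [hs₁, update_of_ne (by omega)]
        exact hs k hk) hJ₁ hf₁
    refine ⟨(i, m) :: l, c', f', .cons hstep hl, hnd, ?_, hs'.trans hs₁, hf', ?_, ?_⟩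
    · intro u
      have : trail c.word ((i, m) :: l) = c₁.word :: trail c₁.word l := rfl
      rw [this, hmem, sameBelow_succ_iff, hm₁, hb, Finset.mem_singleton]
      exact and_congr_left fun _ => ⟨hsame.trans, hsame.symm.trans⟩
    · rcases hcase with ⟨h1, rfl⟩ | ⟨h1, h2, -⟩
      · exact (hf'.unique hf₁).trans_le hf₁m
      · exact h2.le
    · rcases hcase with ⟨h1, rfl⟩ | ⟨h1, h2, h3⟩
      · have : f' = m := by
          have := hf'.unique hf₁
          omega
        rw [hj₁, this]
      · rw [h3, hj₁]
        funext k
        have := hJ m le_rfl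
        simp only [update_apply] at this ⊢
        split_ifs at * <;> first | omega | rfl | simp_all
  | succ r ihr =>
    intro c f hw hs hf hfm hj hJ hcard
    obtain ⟨b, hbl⟩ : ∃ b, IsLeast (cand c.word (c.start m) m : Set ℕ) b := by
      have hne : (cand c.word (c.start m) m).Nonempty := Finset.card_pos.1 (by omega)
      exact ⟨_, Finset.isLeast_min' _ hne⟩
    have hb : cand c.word (c.start m) m ≠ {b} := by
      intro h
      rw [h] at hcard
      simp at hcard
    obtain ⟨⟨k, hk, hkb⟩, -⟩ := mem_cand.1 hbl.1
    obtain ⟨i, hi⟩ : ∃ i, IsLeast {k | c.word k = b} i :=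
      ⟨sInf {k | c.word k = b}, Nat.sInf_mem (s := {k | c.word k = b}) ⟨k, hkb⟩,
        fun _ h => Nat.sInf_le h⟩
    have hib : c.word i = b := hi.1
    have him : i < m := (hi.2 hkb).trans_lt hk
    have hstep := Step.mk hf hj hmn hbl hi
    set c₁ := c.advance f m i b with hc₁
    have hw₁ : c₁.word = c.word ∘ Equiv.swap i m := rfl
    have hs₁ : c₁.start = update c.start m (startSym c.word (c.start m) m) := by
      simp [hc₁, Config.advance, hb]
    have hj₁ : c₁.jump = update c.jump f f := by simp [hc₁, Config.advance, hb]
    have hsame : SameBelow (m + 1) c.word c₁.word := sameBelow_swap _ him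
    have hm₁ : c₁.word m = b := by simp [hw₁, hib]
    have hst : startSym c.word (c.start m) m ≠ 0 := by
      unfold startSym
      split_ifs with h0
      · exact hw m hmn
      · exact h0
    obtain ⟨f₁, hf₁⟩ := FirstChange.exists (show 1 ≤ n by omega) c₁.word
    have hf₁m : f₁ ≤ m := by
      refine hf₁.le_of_ne him ?_
      rw [hm₁, hw₁]
      simpa using (ne_of_mem_cand hbl.1).symm
    have hwn₁ := hsame.ne_zero hmn hw
    obtain ⟨l, c₂, f₂, hl, hnd, hmem, hs₂, hf₂, hcase⟩ := ih c₁ f₁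
      hwn₁ (by
        intro k hk
        rw [hs₁, update_of_ne (by omega)]
        exact hs k hk) (by
        intro k hk
        rw [hj₁]
        exact hJ k hk.le) hf₁
    have hsame₂ : SameBelow m c₁.word c₂.word := (hmem _).1 hl.word_mem
    have hsame₂' := (sameBelow_succ_iff.1 hsame₂)
    -- the focus pointers are back in the shape they had before the step
    have hready : f₂ ≤ m ∧ c₂.jump f₂ = m ∧ update c₂.jump f₂ f₂ = update c.jump f f := by
      rcases hcase with ⟨h1, h2⟩ | ⟨h1, h2, h3⟩
      · subst h2
        have h4 : f₂ = m := by
          have := hf₂.unique hf₁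
          omega
        have h5 := hJ m le_rfl
        rw [h4, hj₁]
        refine ⟨le_rfl, h5, ?_⟩
        funext k
        by_cases hk : k = m
        · rw [hk, update_self, h5]
        · rw [update_of_ne hk]
      · have h5 := hJ m le_rfl
        have h6 := hJ f₂ h2.le
        refine ⟨h2.le, ?_, ?_⟩
        · rw [h3, update_of_ne (by omega), update_self, hj₁, h5]
        · rw [h3, hj₁]
          funext k
          by_cases hk : k = f₂
          · rw [hk, update_self, h6]
          · rw [update_of_ne hk]
            by_cases hk' : k = m
            · rw [hk', update_self, h5]
            · rw [update_of_ne hk', update_of_ne hk]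
    have hcand₂ : cand c₂.word (c₂.start m) m = (cand c.word (c.start m) m).erase b := by
      rw [cand_congr hsame₂, hs₂, hs₁, update_self, hw₁]
      exact cand_swap hbl hib him hst
    obtain ⟨l', c', f', hl', hnd', hmem', hs', hf', hf'm, hj'⟩ := ihr c₂ f₂
      (hsame₂.ne_zero hmn.le hwn₁) (by
        intro k hk
        rw [hs₂, hs₁, update_of_ne (by omega)]
        exact hs k hk) hf₂ hready.1 hready.2.1 (by
        rw [hready.2.2]
        exact hJ) (by rw [hcand₂, Finset.card_erase_of_mem hbl.1]; omega)
    have htr : trail c.word ((i, m) :: l ++ l') =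
        (c₁.word :: trail c₁.word l) ++ trail c₂.word l' := by
      rw [List.cons_append, List.cons_append, ← hl.trail_append l']
      rfl
    have hmem₁ : ∀ u, u ∈ c₁.word :: trail c₁.word l ↔ SameBelow (m + 1) c.word u ∧ u m = b := by
      intro u
      rw [hmem, sameBelow_succ_iff, hm₁]
      exact and_congr_left fun _ => ⟨hsame.trans, hsame.symm.trans⟩
    have hmem₂ : ∀ u, u ∈ trail c₂.word l' ↔
        SameBelow (m + 1) c.word u ∧ u m ∈ (cand c.word (c.start m) m).erase b := by
      intro u
      rw [hmem', hcand₂]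
      have h := hsame.trans hsame₂'.1
      exact and_congr_left fun _ => ⟨h.trans, h.symm.trans⟩
    refine ⟨(i, m) :: l ++ l', c', f', (Steps.cons hstep hl).append hl', ?_, ?_, ?_, hf', hf'm, ?_⟩
    · rw [htr, List.nodup_append]
      refine ⟨hnd, hnd', fun u hu v hv huv => ?_⟩
      subst huv
      have h1 := ((hmem₁ u).1 hu).2
      have h2 := ((hmem₂ u).1 hv).2
      rw [h1] at h2
      simp at h2
    · intro u
      rw [htr, List.mem_append, hmem₁, hmem₂, ← and_or_left, Finset.mem_erase]
      refine and_congr_right fun _ => ⟨?_, ?_⟩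
      · rintro (h | h)
        · rw [h]
          exact hbl.1
        · exact h.2
      · intro h
        by_cases h1 : u m = b
        · exact .inl h1
        · exact .inr ⟨h1, h⟩
    · rw [hs', hs₂, hs₁, update_idem]
    · rw [hj', hready.2.2]
      congr 2
      have h1 := congrFun hready.2.2 (m + 1)
      rwa [update_of_ne (by omega), update_of_ne (by omega)] at h1

/-- When no level below `m` is in progress or exhausted, the enumeration first runs through all
rearrangements of the first `m` symbols, after which the levels below `m` form a run of exhausted
levels (unless the first `m` symbols agree, in which case there is nothing to do). -/
theorem enum_prefix {n m : ℕ} (hmn : m ≤ n) : EnumeratesBelow n m := by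
  induction m with
  | zero =>
    intro c f hw hs hJ hf
    exact ⟨[], c, f, .nil c, by simp [trail], fun u => by
      rw [sameBelow_const_iff hf (Nat.zero_le _)]
      simp [trail], rfl, hf, .inl ⟨Nat.zero_le _, rfl⟩⟩
  | succ m ih =>
    intro c f hw hs hJ hf
    by_cases hfm : m + 1 ≤ f
    · exact ⟨[], c, f, .nil c, by simp [trail], fun u => by
        rw [sameBelow_const_iff hf hfm]
        simp [trail], rfl, hf, .inl ⟨hfm, rfl⟩⟩
    · have hfm : f < m + 1 := by omega
      have ih := ih (by omega)
      obtain ⟨l, c₂, f₂, hl, hnd, hmem, hs₂, hf₂, hcase⟩ := ih c f hw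
        (fun k hk => hs k (by omega)) (fun k hk => hJ k (by omega)) hf
      have hsame₂ : SameBelow m c.word c₂.word := (hmem _).1 hl.word_mem
      have hsame₂' := (sameBelow_succ_iff.1 hsame₂)
      have h5 := hJ m (by omega)
      have hready : f₂ ≤ m ∧ c₂.jump f₂ = m ∧ update c₂.jump f₂ f₂ = c.jump := by
        rcases hcase with ⟨h1, h2⟩ | ⟨h1, h2, h3⟩
        · subst h2
          have h4 : f₂ = m := by
            have := hf₂.unique hf
            omega
          rw [h4]
          refine ⟨le_rfl, h5, ?_⟩
          exact update_eq_self_iff.2 h5.symm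
        · have h6 := hJ f₂ (by omega)
          refine ⟨h2.le, ?_, ?_⟩
          · rw [h3, update_of_ne (by omega), update_self, h5]
          · rw [h3]
            funext k
            by_cases hk : k = f₂
            · rw [hk, update_self, h6]
            · rw [update_of_ne hk]
              by_cases hk' : k = m
              · rw [hk', update_self, h5]
              · rw [update_of_ne hk', update_of_ne hk]
      have h0 : c₂.start m = 0 := by
        rw [hs₂]
        exact hs m (by omega)
      have hwn₂ := hsame₂.ne_zero (show m ≤ n by omega) hw
      have hcand : ∀ a, a ∈ cand c₂.word (c₂.start m) m ↔
          (∃ k < m + 1, c₂.word k = a) ∧ a ≠ c₂.word m := by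
        intro a
        rw [mem_cand, h0, startSym, if_pos rfl, if_pos rfl]
        constructor
        · rintro ⟨⟨k, hk, h⟩, -, h'⟩
          exact ⟨⟨k, by omega, h⟩, h'⟩
        · rintro ⟨⟨k, hk, h⟩, h'⟩
          have : k ≠ m := by
            rintro rfl
            exact h' h.symm
          refine ⟨⟨k, by omega, h⟩, ?_, h'⟩
          rw [← h]
          exact Nat.pos_of_ne_zero (hwn₂ k (by omega))
      -- the first `m + 1` symbols are not all equal, so level `m` has a candidate
      have hne : 0 < (cand c₂.word (c₂.start m) m).card := by
        rw [Finset.card_pos]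
        by_cases h : c₂.word m = c₂.word 0
        · exact ⟨_, (hcand _).2 ⟨⟨f₂, by omega, rfl⟩, h ▸ hf₂.ne (by omega)⟩⟩
        · exact ⟨_, (hcand _).2 ⟨⟨0, by omega, rfl⟩, fun h' => h h'.symm⟩⟩
      obtain ⟨r, hr⟩ := Nat.exists_eq_succ_of_ne_zero hne.ne'
      obtain ⟨l', c', f', hl', hnd', hmem', hs', hf', hf'm, hj'⟩ := enum_level (by omega) ih r c₂ f₂
        hwn₂ (fun k hk => by
          rw [hs₂]
          exact hs k (by omega)) hf₂ hready.1 hready.2.1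
        (by
          rw [hready.2.2]
          exact fun k hk => hJ k (by omega)) hr
      have htr : c.word :: trail c.word (l ++ l') =
          (c.word :: trail c.word l) ++ trail c₂.word l' := by
        rw [hl.trail_append l']
        rfl
      have hmem₂ : ∀ u, u ∈ trail c₂.word l' ↔ SameBelow (m + 1) c.word u ∧ u m ≠ c.word m := by
        intro u
        rw [hmem', hcand, hsame₂'.2]
        constructor
        · rintro ⟨h1, -, h2⟩
          exact ⟨hsame₂'.1.trans h1, h2⟩
        · rintro ⟨h1, h2⟩
          have h3 := hsame₂'.1.symm.trans h1
          exact ⟨h3, h3.exists_eq (by omega), h2⟩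
      refine ⟨l ++ l', c', f', hl.append hl', ?_, ?_, ?_, hf', .inr ⟨hfm, by omega, ?_⟩⟩
      · rw [htr, List.nodup_append]
        refine ⟨hnd, hnd', fun u hu v hv huv => ?_⟩
        subst huv
        exact ((hmem₂ u).1 hv).2 ((sameBelow_succ_iff.1 ((hmem u).1 hu)).2)
      · intro u
        rw [htr, List.mem_append, hmem, hmem₂, sameBelow_succ_iff, ← and_or_left]
        exact ⟨fun h => h.1, fun h => ⟨h, em _⟩⟩
      · rw [hs', hs₂]
        exact update_eq_self_iff.2 (hs m (by omega)).symm
      · rw [hj', hready.2.2]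
        congr 2
        have h1 := congrFun hready.2.2 (m + 1)
        rwa [update_of_ne (by omega)] at h1

/-- From any word without zeros the enumeration visits every rearrangement exactly once; it ends
when the focus pointer leads to `n`. -/
theorem exists_steps {n : ℕ} (hn : 1 ≤ n) (w : ℕ → ℕ) (hw : ∀ k < n, w k ≠ 0) :
    ∃ (l : List (ℕ × ℕ)) (c' : Config) (f : ℕ), Steps n ⟨w, fun _ => 0, id⟩ l c' ∧
      (w :: trail w l).Nodup ∧ (∀ u, u ∈ w :: trail w l ↔ SameBelow n w u) ∧
      FirstChange n c'.word f ∧ c'.jump f = n := by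
  obtain ⟨f, hf⟩ := FirstChange.exists hn w
  obtain ⟨l, c', f', hl, hnd, hmem, -, hf', hcase⟩ := enum_prefix (le_refl n)
    ⟨w, fun _ => 0, id⟩ f hw (fun _ _ => rfl) (fun _ _ => rfl) hf
  refine ⟨l, c', f', hl, hnd, hmem, hf', ?_⟩
  rcases hcase with ⟨h1, rfl⟩ | ⟨h1, h2, h3⟩
  · have := hf'.le
    have := hf'.unique hf
    simp only [id]
    omega
  · rw [h3, update_of_ne (by omega), update_self]
    rfl

/-! ### The enumeration as a walk in the configuration graph -/

/-- The word `w` as a function on `ℕ`: symbols are counted from 1, and positions past the end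
carry 0. -/
def extWord {σ n : ℕ} (w : Fin n → Fin σ) (k : ℕ) : ℕ := if h : k < n then (w ⟨k, h⟩).1 + 1 else 0

theorem extWord_fin {σ n : ℕ} (w : Fin n → Fin σ) (k : Fin n) : extWord w k.1 = (w k).1 + 1 := by
  simp [extWord]

theorem extWord_injective {σ n : ℕ} : Injective (extWord (σ := σ) (n := n)) := by
  intro w u h
  funext k
  have := congrFun h k.1
  rw [extWord_fin, extWord_fin] at this
  exact Fin.ext (by omega)

theorem extWord_swap {σ n : ℕ} (w : Fin n → Fin σ) (i j : Fin n) :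
    extWord (w ∘ Equiv.swap i j) = extWord w ∘ Equiv.swap i.1 j.1 := by
  funext k
  by_cases hk : k < n
  · have h1 : Equiv.swap i.1 j.1 k = (Equiv.swap i j ⟨k, hk⟩).1 := by
      rw [Equiv.swap_apply_def, Equiv.swap_apply_def]
      simp only [Fin.ext_iff]
      split_ifs <;> rfl
    rw [comp_apply, h1, extWord_fin]
    simp [extWord, hk]
  · have hi := i.2
    have hj := j.2
    rw [comp_apply, Equiv.swap_apply_of_ne_of_ne (by omega) (by omega)]
    simp [extWord, hk]

theorem parikh_swap {σ n : ℕ} (w : Fin n → Fin σ) (i j : Fin n) :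
    parikh (w ∘ Equiv.swap i j) = parikh w := by
  funext a
  refine Finset.card_bij (fun k _ => Equiv.swap i j k) ?_ ?_ ?_
  · intro k hk
    simpa using hk
  · intro k _ k' _ h
    exact (Equiv.swap i j).injective h
  · intro k hk
    exact ⟨Equiv.swap i j k, by simpa using hk, by simp⟩

theorem card_filter_extWord {σ n : ℕ} (w : Fin n → Fin σ) (a : ℕ) :
    ((Finset.range n).filter (extWord w · = a)).card =
      (Finset.univ.filter fun k : Fin n => (w k).1 + 1 = a).card := by
  symm
  refine Finset.card_bij (fun k _ => k.1) ?_ ?_ ?_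
  · intro k hk
    simpa [extWord_fin] using hk
  · intro k _ k' _ h
    exact Fin.ext h
  · intro k hk
    simp only [Finset.mem_filter, Finset.mem_range] at hk
    refine ⟨⟨k, hk.1⟩, ?_, rfl⟩
    rw [Finset.mem_filter, ← extWord_fin]
    exact ⟨Finset.mem_univ _, hk.2⟩

theorem sameBelow_extWord {σ n : ℕ} {w u : Fin n → Fin σ} (h : parikh w = parikh u) :
    SameBelow n (extWord w) (extWord u) := by
  refine ⟨fun k hk => by simp [extWord, hk.not_gt], fun a => ?_⟩
  rw [card_filter_extWord, card_filter_extWord]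
  by_cases ha : 1 ≤ a ∧ a ≤ σ
  · have key : ∀ v : Fin n → Fin σ, (Finset.univ.filter fun k : Fin n => (v k).1 + 1 = a).card =
        parikh v ⟨a - 1, by omega⟩ := by
      intro v
      unfold parikh
      congr 1
      ext k
      simp only [Finset.mem_filter, Finset.mem_univ, true_and, Fin.ext_iff]
      omega
    rw [key, key, h]
  · have key : ∀ v : Fin n → Fin σ,
        (Finset.univ.filter fun k : Fin n => (v k).1 + 1 = a).card = 0 := by
      intro v
      rw [Finset.card_eq_zero, Finset.filter_eq_empty_iff]
      intro k _
      have := (v k).2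
      omega
    rw [key, key]

theorem Step.swap_spec {n : ℕ} {c c' : Config} {i m : ℕ} (h : Step n c i m c') :
    i < m ∧ m < n ∧ c.word i ≠ c.word m := by
  obtain ⟨hf, hj, hm, hb, hi⟩ := h
  obtain ⟨⟨k, hk, hkb⟩, -⟩ := mem_cand.1 hb.1
  refine ⟨(hi.2 hkb).trans_lt hk, hm, ?_⟩
  have : c.word i = _ := hi.1
  rw [this]
  exact ne_of_mem_cand hb.1

/-- A run of the enumeration is a walk in the configuration graph. -/
theorem Steps.exists_walk {σ n : ℕ} {P : Fin σ → ℕ} {c c' : Config} {l : List (ℕ × ℕ)}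
    (h : Steps n c l c') : ∀ w : ParikhWord n P, extWord w.1 = c.word →
      ∃ (v : ParikhWord n P) (q : (configGraph n P).Walk w v),
        Records q (l.map fun e => (e.1 + 1, e.2 + 1)) ∧
        q.support.map (fun u => extWord u.1) = c.word :: trail c.word l := by
  induction h with
  | nil c => exact fun w hw => ⟨w, .nil, by simp [Records], by simp [trail, hw]⟩
  | @cons c c' c'' i m l h hl ih =>
    intro w hw
    obtain ⟨him, hmn, hne⟩ := h.swap_spec
    set i' : Fin n := ⟨i, by omega⟩
    set m' : Fin n := ⟨m, hmn⟩
    have hswap : IsTwoSwap w.1 i' m' (w.1 ∘ Equiv.swap i' m') := by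
      refine ⟨him, fun he => hne ?_, rfl⟩
      rw [← hw]
      have h1 := extWord_fin w.1 i'
      rw [he, ← extWord_fin] at h1
      exact h1
    have hw' : extWord (w.1 ∘ Equiv.swap i' m') = c'.word := by
      rw [extWord_swap, hw, h.word_eq]
    obtain ⟨v, q, hq, hsupp⟩ := ih ⟨w.1 ∘ Equiv.swap i' m', by rw [parikh_swap, w.2]⟩ hw'
    have hadj : (configGraph n P).Adj w
        ⟨w.1 ∘ Equiv.swap i' m', by rw [parikh_swap, w.2]⟩ := ⟨i', m', hswap⟩
    refine ⟨v, .cons hadj q, ?_, ?_⟩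
    · rw [Records]
      exact ⟨i', m', _, hswap, rfl, hq⟩
    · rw [SimpleGraph.Walk.support_cons, List.map_cons, hsupp, hw, trail, ← h.word_eq]

/-- The run from a word `w` with nothing in progress is a Hamiltonian path from `w`. -/
theorem exists_hamiltonian {σ n : ℕ} {P : Fin σ → ℕ} (hn : 1 ≤ n) (w : ParikhWord n P) :
    ∃ (l : List (ℕ × ℕ)) (c' : Config) (f : ℕ), Steps n ⟨extWord w.1, fun _ => 0, id⟩ l c' ∧
      FirstChange n c'.word f ∧ c'.jump f = n ∧
      ∃ (v : ParikhWord n P) (q : (configGraph n P).Walk w v),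
        q.IsHamiltonian ∧ Records q (l.map fun e => (e.1 + 1, e.2 + 1)) := by
  obtain ⟨l, c', f, hl, hnd, hmem, hf, hj⟩ := exists_steps hn (extWord w.1)
    (fun k hk => by simp [extWord, hk])
  refine ⟨l, c', f, hl, hf, hj, ?_⟩
  obtain ⟨v, q, hq, hsupp⟩ := hl.exists_walk w rfl
  rw [← hsupp] at hnd
  refine ⟨v, q, SimpleGraph.Walk.IsPath.isHamiltonian_of_mem (.mk' hnd.of_map) fun u => ?_, hq⟩
  have h1 : extWord u.1 ∈ q.support.map (fun u => extWord u.1) := by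
    rw [hsupp]
    exact (hmem _).2 (sameBelow_extWord (w.2.trans u.2.symm))
  obtain ⟨u', hu', he⟩ := List.mem_map.1 h1
  have h2 : u' = u := Subtype.ext (extWord_injective he)
  exact h2 ▸ hu'

/-- When there is at most one position, no two words are adjacent, and the only word is a
Hamiltonian path. -/
theorem exists_hamiltonian_of_le_one {σ n : ℕ} {P : Fin σ → ℕ} (hn : n ≤ 1) (w : ParikhWord n P) :
    ∃ (v : ParikhWord n P) (q : (configGraph n P).Walk w v), q.IsHamiltonian ∧ Records q [] := by
  refine ⟨w, .nil, fun u => ?_, rfl⟩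
  have h : u = w := by
    refine Subtype.ext (extWord_injective ?_)
    have h1 := sameBelow_extWord (w.2.trans u.2.symm)
    have h2 := (sameBelow_const_iff (n := 1) (f := 1) (w := extWord w.1) (u := extWord u.1)
      ⟨le_rfl, le_rfl, by simp, by simp⟩ hn).1 h1
    exact h2
  subst h
  simp

/-! ### Reasoning about programs -/

theorem quiet_append (a b : ℕ) : quiet a ++ quiet b = quiet (a + b) :=
  List.replicate_append_replicate

theorem outputs_append (t t' : Trace) : outputs (t ++ t') = outputs t ++ outputs t' :=
  List.reduceOption_append t t'

theorem outputs_quiet (k : ℕ) : outputs (quiet k) = [] := by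
  induction k with
  | zero => rfl
  | succ k ih => exact ih

theorem outputs_some_cons (x : ℕ × ℕ) (t : Trace) : outputs (some x :: t) = x :: outputs t := rfl

/-- Started in `s`, the program halts after at most `K` steps, without output, in a state
with `Q`. -/
def Quiet (B : ℕ) (p : Prog) (s : State) (K : ℕ) (Q : State → Prop) : Prop :=
  ∃ (k : ℕ) (s' : State), k ≤ K ∧ Exec B p s (quiet k) s' ∧ Q s'

/-- Started in `s`, the program halts after at most `K` steps; its outputs and its final state
satisfy `Q`. -/
def Runs (B : ℕ) (p : Prog) (s : State) (K : ℕ) (Q : List (ℕ × ℕ) → State → Prop) : Prop :=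
  ∃ (t : Trace) (s' : State), t.length ≤ K ∧ Exec B p s t s' ∧ Q (outputs t) s'

/-- Started in `s`, the program makes the single output `x`, takes at most `K` steps before and at
most `K` after it, and halts in a state with `Q`. -/
def Emits (B : ℕ) (p : Prog) (s : State) (K : ℕ) (x : ℕ × ℕ) (Q : State → Prop) : Prop :=
  ∃ (k k' : ℕ) (s' : State), k ≤ K ∧ k' ≤ K ∧ Exec B p s (quiet k ++ some x :: quiet k') s' ∧ Q s'

section Rules

variable {B K K' : ℕ} {p q : Prog} {e : Expr} {s : State}

theorem Quiet.mono {Q Q' : State → Prop} (h : Quiet B p s K Q) (hK : K ≤ K')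
    (hQ : ∀ s', Q s' → Q' s') : Quiet B p s K' Q' := by
  obtain ⟨k, s', hk, he, hq⟩ := h
  exact ⟨k, s', hk.trans hK, he, hQ _ hq⟩

theorem Quiet.seq {R Q : State → Prop} (hp : Quiet B p s K R)
    (hq : ∀ s', R s' → Quiet B q s' K' Q) : Quiet B (.seq p q) s (K + K') Q := by
  obtain ⟨k, s', hk, he, hr⟩ := hp
  obtain ⟨k', s'', hk', he', hr'⟩ := hq s' hr
  exact ⟨k + k', s'', by omega, quiet_append k k' ▸ he.seq he', hr'⟩

/-- The rule for a loop of `i` rounds, with an invariant `I` that counts down the rounds left. -/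
theorem Quiet.loop (I : ℕ → State → Prop) (h0 : ∀ s, I 0 s → e.Fits B s ∧ e.eval s = 0)
    (hs : ∀ i s, I (i + 1) s → e.Fits B s ∧ e.eval s ≠ 0 ∧ Quiet B p s K (I i)) :
    ∀ i s, I i s → Quiet B (.loop e p) s (i * (K + e.cost + 1) + (e.cost + 1)) (I 0) := by
  intro i
  induction i with
  | zero =>
    intro s h
    obtain ⟨h1, h2⟩ := h0 s h
    exact ⟨e.cost + 1, s, by omega, .loopDone h1 h2, h⟩
  | succ i ih =>
    intro s h
    obtain ⟨h1, h2, k, s', hk, he, hI⟩ := hs i s h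
    obtain ⟨k', s'', hk', he', hI'⟩ := ih s' hI
    refine ⟨e.cost + 1 + k + k', s'', ?_, ?_, hI'⟩
    · rw [Nat.succ_mul]
      omega
    · rw [← quiet_append, ← quiet_append]
      exact .loopStep h1 h2 he he'

theorem Quiet.runs {Q : State → Prop} (h : Quiet B p s K Q) :
    Runs B p s K fun o s' => o = [] ∧ Q s' := by
  obtain ⟨k, s', hk, he, hq⟩ := h
  exact ⟨quiet k, s', by simpa [quiet] using hk, he, outputs_quiet k, hq⟩

theorem Runs.mono {Q Q' : List (ℕ × ℕ) → State → Prop} (h : Runs B p s K Q) (hK : K ≤ K')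
    (hQ : ∀ o s', Q o s' → Q' o s') : Runs B p s K' Q' := by
  obtain ⟨t, s', hk, he, hq⟩ := h
  exact ⟨t, s', hk.trans hK, he, hQ _ _ hq⟩

theorem Runs.seq {R Q : List (ℕ × ℕ) → State → Prop} (hp : Runs B p s K R)
    (hq : ∀ o s', R o s' → Runs B q s' K' fun o' s'' => Q (o ++ o') s'') :
    Runs B (.seq p q) s (K + K') Q := by
  obtain ⟨t, s', hk, he, hr⟩ := hp
  obtain ⟨t', s'', hk', he', hr'⟩ := hq _ s' hr
  refine ⟨t ++ t', s'', ?_, he.seq he', ?_⟩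
  · rw [List.length_append]
    omega
  · rwa [outputs_append]

theorem Runs.loop (I : ℕ → List (ℕ × ℕ) → State → Prop)
    (h0 : ∀ o s, I 0 o s → e.Fits B s ∧ e.eval s = 0)
    (hs : ∀ i o s, I (i + 1) o s →
      e.Fits B s ∧ e.eval s ≠ 0 ∧ Runs B p s K fun o' s' => I i (o ++ o') s') :
    ∀ i o s, I i o s → Runs B (.loop e p) s (i * (K + e.cost + 1) + (e.cost + 1))
      fun o' s' => I 0 (o ++ o') s' := by
  intro i
  induction i with
  | zero =>
    intro o s h
    obtain ⟨h1, h2⟩ := h0 o s h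
    exact ⟨quiet (e.cost + 1), s, by simp [quiet], .loopDone h1 h2, by simpa [outputs_quiet]⟩
  | succ i ih =>
    intro o s h
    obtain ⟨h1, h2, t, s', hk, he, hI⟩ := hs i o s h
    obtain ⟨t', s'', hk', he', hI'⟩ := ih _ s' hI
    refine ⟨quiet (e.cost + 1) ++ t ++ t', s'', ?_, .loopStep h1 h2 he he', ?_⟩
    · rw [Nat.succ_mul]
      simp only [List.length_append, quiet, List.length_replicate]
      omega
    · rw [outputs_append, outputs_append, outputs_quiet, List.nil_append]
      change I 0 (o ++ (outputs t ++ outputs t')) s''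
      rwa [← List.append_assoc]

theorem Quiet.seq_emits {R Q : State → Prop} {x : ℕ × ℕ} (hp : Quiet B p s K R)
    (hq : ∀ s', R s' → Emits B q s' K' x Q) : Emits B (.seq p q) s (K + K') x Q := by
  obtain ⟨k, s', hk, he, hr⟩ := hp
  obtain ⟨k₁, k₂, s'', hk₁, hk₂, he', hr'⟩ := hq s' hr
  refine ⟨k + k₁, k₂, s'', by omega, by omega, ?_, hr'⟩
  rw [← quiet_append, List.append_assoc]
  exact he.seq he'

theorem Emits.seq {R Q : State → Prop} {x : ℕ × ℕ} (hp : Emits B p s K x R)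
    (hq : ∀ s', R s' → Quiet B q s' K' Q) : Emits B (.seq p q) s (K + K') x Q := by
  obtain ⟨k₁, k₂, s', hk₁, hk₂, he, hr⟩ := hp
  obtain ⟨k, s'', hk, he', hr'⟩ := hq s' hr
  refine ⟨k₁, k₂ + k, s'', by omega, by omega, ?_, hr'⟩
  rw [← quiet_append, ← List.cons_append, ← List.append_assoc]
  exact he.seq he'

theorem Emits.mono {Q Q' : State → Prop} {x : ℕ × ℕ} (h : Emits B p s K x Q) (hK : K ≤ K')
    (hQ : ∀ s', Q s' → Q' s') : Emits B p s K' x Q' := by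
  obtain ⟨k, k', s', hk, hk', he, hq⟩ := h
  exact ⟨k, k', s', hk.trans hK, hk'.trans hK, he, hQ _ hq⟩

theorem Emits.out {a b : Expr} (ha : a.Fits B s) (hb : b.Fits B s) :
    Emits B (.out a b) s (a.cost + b.cost) (a.eval s, b.eval s) (· = s) :=
  ⟨_, 0, s, le_rfl, Nat.zero_le _, .out a b s ha hb, rfl⟩

theorem Emits.iteTrue {Q : State → Prop} {x : ℕ × ℕ} (hf : e.Fits B s) (he : e.eval s ≠ 0)
    (hp : Emits B p s K x Q) : Emits B (.ite e p q) s (e.cost + 1 + K) x Q := by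
  obtain ⟨k₁, k₂, s', hk₁, hk₂, h, hr⟩ := hp
  refine ⟨e.cost + 1 + k₁, k₂, s', by omega, by omega, ?_, hr⟩
  rw [← quiet_append, List.append_assoc]
  exact .iteTrue hf he h

theorem Quiet.iteFalse {Q : State → Prop} (hf : e.Fits B s) (he : e.eval s = 0)
    (hq : Quiet B q s K Q) : Quiet B (.ite e p q) s (e.cost + 1 + K) Q := by
  obtain ⟨k, s', hk, h, hr⟩ := hq
  refine ⟨e.cost + 1 + k, s', by omega, ?_, hr⟩
  rw [← quiet_append]
  exact .iteFalse hf he h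

theorem Emits.runs {Q : State → Prop} {x : ℕ × ℕ} (h : Emits B p s K x Q) :
    Runs B p s (2 * K + 1) fun o s' => o = [x] ∧ Q s' := by
  obtain ⟨k₁, k₂, s', hk₁, hk₂, h, hr⟩ := h
  refine ⟨_, s', ?_, h, ?_, hr⟩
  · simp only [quiet, List.length_append, List.length_cons, List.length_replicate]
    omega
  · rw [outputs_append, outputs_quiet, outputs_some_cons, outputs_quiet]
    rfl

end Rules

/-! ### Straight-line programs -/

/-- The final state of a program without loops and outputs. -/
def Prog.run : Prog → State → State
  | .assign r e, s => ⟨Function.update s.reg r (e.eval s), s.mem⟩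
  | .store a e, s => ⟨s.reg, Function.update s.mem (a.eval s) (e.eval s)⟩
  | .seq p q, s => q.run (p.run s)
  | .ite e p q, s => if e.eval s ≠ 0 then p.run s else q.run s
  | _, s => s

/-- A bound on the number of steps of a program without loops and outputs. -/
def Prog.steps : Prog → ℕ
  | .skip => 1
  | .assign _ e => e.cost + 1
  | .store a e => a.cost + e.cost + 1
  | .seq p q => p.steps + q.steps
  | .ite e p q => e.cost + 1 + max p.steps q.steps
  | _ => 0

/-- The program has no loops and outputs, and all numbers that occur when it is started in the
given state fit in a machine word. -/
def Prog.Fits (B : ℕ) : Prog → State → Prop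
  | .skip, _ => True
  | .assign _ e, s => e.Fits B s
  | .store a e, s => a.Fits B s ∧ e.Fits B s
  | .seq p q, s => p.Fits B s ∧ q.Fits B (p.run s)
  | .ite e p q, s => e.Fits B s ∧ (e.eval s ≠ 0 → p.Fits B s) ∧ (e.eval s = 0 → q.Fits B s)
  | _, _ => False

theorem Prog.Fits.quiet {B : ℕ} {p : Prog} : ∀ {s : State}, p.Fits B s →
    Quiet B p s p.steps (· = p.run s) := by
  induction p with
  | skip => exact fun _ => ⟨1, _, le_rfl, .skip _, rfl⟩
  | assign r e => exact fun h => ⟨_, _, le_rfl, .assign r e _ h, rfl⟩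
  | store a e => exact fun h => ⟨_, _, le_rfl, .store a e _ h.1 h.2, rfl⟩
  | out => exact fun h => h.elim
  | loop => exact fun h => h.elim
  | seq p q ihp ihq =>
    intro s h
    exact (ihp h.1).seq fun s' hs' => by
      subst hs'
      exact ihq h.2
  | ite e p q ihp ihq =>
    intro s h
    by_cases he : e.eval s = 0
    · refine (Quiet.iteFalse h.1 he (ihq (h.2.2 he))).mono ?_ ?_
      · simp only [Prog.steps]
        omega
      · rintro s' rfl
        simp [Prog.run, he]
    · obtain ⟨k, s', hk, h', rfl⟩ := ihp (h.2.1 he)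
      refine ⟨e.cost + 1 + k, p.run s, ?_, ?_, ?_⟩
      · simp only [Prog.steps]
        omega
      · rw [← quiet_append]
        exact .iteTrue h.1 he h'
      · simp [Prog.run, he]

/-! ### Delays -/

theorem delayLE_quiet {k D : ℕ} (h : k ≤ D) : DelayLE (quiet k) D := by
  intro q hq _
  have := hq.length_le
  simp only [quiet, List.length_replicate] at this
  omega

theorem DelayLE.quiet_append_some {t : Trace} {D : ℕ} (ht : DelayLE t D) (x : ℕ × ℕ) {a : ℕ}
    (ha : a ≤ D) : DelayLE (quiet a ++ some x :: t) D := by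
  -- a stretch without output that begins at the start of the trace ends before the output `x`
  have hpre : ∀ (a : ℕ) (q : Trace), q <+: quiet a ++ some x :: t → (∀ y ∈ q, y = none) →
      q.length ≤ a := by
    intro a q hq hn
    by_contra hlt
    have hlt : a < q.length := by omega
    have h1 := hq.getElem hlt
    have h2 := hn _ (List.getElem_mem hlt)
    rw [h2, List.getElem_append_right (by simp [quiet])] at h1
    simp [quiet] at h1
  induction a with
  | zero =>
    intro q hq hn
    rcases List.infix_cons_iff.1 hq with h | h
    · exact (hpre 0 q h hn).trans ha
    · exact ht q h hn
  | succ a ih =>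
    intro q hq hn
    have hcons : quiet (a + 1) ++ some x :: t = none :: (quiet a ++ some x :: t) := rfl
    rw [hcons] at hq
    rcases List.infix_cons_iff.1 hq with h | h
    · rw [← hcons] at h
      exact (hpre _ q h hn).trans ha
    · exact ih (by omega) q h hn

/-! ### Tournament trees -/

/-- `T` is a tournament tree over the leaf entries `g 0, …, g (2 ^ h - 1)` in heap order: leaf `i`
is node `2 ^ h + i`, the children of node `v` are the nodes `2 * v` and `2 * v + 1`, and a node
holds the leftmost nonzero entry below it. All entries are at most `n`. -/
structure Tree (h n : ℕ) (T g : ℕ → ℕ) : Prop where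
  leaf : ∀ i < 2 ^ h, T (2 ^ h + i) = g i
  node : ∀ v, 1 ≤ v → v < 2 ^ h → T v = T (2 * v) + (1 - T (2 * v)) * T (2 * v + 1)
  le : ∀ v < 2 * 2 ^ h, T v ≤ n

/-- The node `v` at height `k` holds the first nonzero entry of the leaves below it, which are the
nodes from `v * 2 ^ k` up to `v * 2 ^ k + 2 ^ k - 1`. -/
theorem Tree.subtree {h n : ℕ} {T g : ℕ → ℕ} (hT : Tree h n T g) (k : ℕ) :
    ∀ v, 2 ^ h ≤ v * 2 ^ k → v * 2 ^ k + 2 ^ k ≤ 2 * 2 ^ h →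
      (T v = 0 → ∀ i, v * 2 ^ k ≤ 2 ^ h + i → i < v * 2 ^ k + 2 ^ k - 2 ^ h → g i = 0) ∧
      (T v ≠ 0 → ∃ i, v * 2 ^ k ≤ 2 ^ h + i ∧ i < v * 2 ^ k + 2 ^ k - 2 ^ h ∧ g i = T v ∧
        ∀ i', v * 2 ^ k ≤ 2 ^ h + i' → i' < i → g i' = 0) := by
  induction k with
  | zero =>
    intro v h1 h2
    have h3 := hT.leaf (v - 2 ^ h) (by omega)
    rw [show 2 ^ h + (v - 2 ^ h) = v by omega] at h3
    constructor
    · intro h0 i hi hi'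
      rw [show i = v - 2 ^ h by omega, ← h3, h0]
    · intro h0
      exact ⟨v - 2 ^ h, by omega, by omega, h3.symm, fun i' _ _ => by omega⟩
  | succ k ih =>
    intro v h1 h2
    have e1 : v * 2 ^ (k + 1) = 2 * v * 2 ^ k := by ring
    have e2 : 2 ^ (k + 1) = 2 ^ k + 2 ^ k := by ring
    have e3 : (2 * v + 1) * 2 ^ k = 2 * v * 2 ^ k + 2 ^ k := by ring
    have hk : 0 < 2 ^ k := by positivity
    rw [e1] at h1 h2 ⊢
    rw [e2] at h2 ⊢
    have hl := ih (2 * v) h1 (by omega)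
    have hr := ih (2 * v + 1) (by omega) (by omega)
    rw [e3] at hr
    have hv : 1 ≤ v := by
      rcases Nat.eq_zero_or_pos v with rfl | h
      · simp at h1
      · exact h
    have hv' : v < 2 ^ h := by
      by_contra hlt
      have : 2 * 2 ^ h * 1 ≤ 2 * v * 2 ^ k := Nat.mul_le_mul (by omega) (by omega)
      omega
    have hn := hT.node v hv hv'
    by_cases h0 : T (2 * v) = 0
    · rw [h0] at hn
      have hn : T v = T (2 * v + 1) := by simpa using hn
      rw [hn]
      constructor
      · intro h0' i hi hi'
        by_cases hlt : i < 2 * v * 2 ^ k + 2 ^ k - 2 ^ h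
        · exact hl.1 h0 i hi hlt
        · exact hr.1 h0' i (by omega) (by omega)
      · intro h0'
        obtain ⟨i, hi1, hi2, hi3, hi4⟩ := hr.2 h0'
        refine ⟨i, by omega, by omega, hi3, fun i' h5 h6 => ?_⟩
        by_cases hlt : i' < 2 * v * 2 ^ k + 2 ^ k - 2 ^ h
        · exact hl.1 h0 i' h5 hlt
        · exact hi4 i' (by omega) h6
    · have hn : T v = T (2 * v) := by
        rw [show 1 - T (2 * v) = 0 by omega] at hn
        simpa using hn
      rw [hn]
      refine ⟨fun h => absurd h h0, fun _ => ?_⟩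
      obtain ⟨i, hi1, hi2, hi3, hi4⟩ := hl.2 h0
      exact ⟨i, hi1, by omega, hi3, hi4⟩

/-- The root of a tournament tree holds the first nonzero leaf entry. -/
theorem Tree.root {h n : ℕ} {T g : ℕ → ℕ} (hT : Tree h n T g) :
    (T 1 = 0 → ∀ i < 2 ^ h, g i = 0) ∧
    (T 1 ≠ 0 → ∃ i < 2 ^ h, g i = T 1 ∧ ∀ i' < i, g i' = 0) := by
  obtain ⟨h1, h2⟩ := hT.subtree h 1 (by omega) (by omega)
  refine ⟨fun h0 i hi => h1 h0 i (by omega) (by omega), fun h0 => ?_⟩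
  obtain ⟨i, hi1, hi2, hi3, hi4⟩ := h2 h0
  exact ⟨i, by omega, hi3, fun i' h => hi4 i' (by omega) h⟩

/-- A tournament tree in which only the proper ancestors of the node `v` need updating. -/
structure TreeExcept (h n v : ℕ) (T g : ℕ → ℕ) : Prop where
  leaf : ∀ i < 2 ^ h, T (2 ^ h + i) = g i
  node : ∀ u, 1 ≤ u → u < 2 ^ h →
    T u = T (2 * u) + (1 - T (2 * u)) * T (2 * u + 1) ∨ ∃ i, u = v / 2 ^ (i + 1)
  le : ∀ u < 2 * 2 ^ h, T u ≤ n

/-- Nodes 0 and 1 have no proper ancestors in the tree. -/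
theorem TreeExcept.tree {h n v : ℕ} {T g : ℕ → ℕ} (hT : TreeExcept h n v T g) (hv : v ≤ 1) :
    Tree h n T g := by
  refine ⟨hT.leaf, fun u hu hu' => ?_, hT.le⟩
  rcases hT.node u hu hu' with h | ⟨i, hi⟩
  · exact h
  · have : v < 2 ^ (i + 1) := by
      have : 2 ≤ 2 ^ (i + 1) := by
        rw [pow_succ]
        have : 0 < 2 ^ i := by positivity
        omega
      omega
    rw [Nat.div_eq_of_lt this] at hi
    omega

/-- Overwriting a leaf spoils only the nodes above it. -/
theorem Tree.setLeaf {h n : ℕ} {T g : ℕ → ℕ} (hT : Tree h n T g) {i x : ℕ} (hi : i < 2 ^ h)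
    (hx : x ≤ n) : TreeExcept h n (2 ^ h + i) (update T (2 ^ h + i) x) (update g i x) := by
  refine ⟨fun i' hi' => ?_, fun u hu hu' => ?_, fun u hu => ?_⟩
  · by_cases h1 : i' = i
    · subst h1
      simp
    · rw [update_of_ne (by omega), update_of_ne h1, hT.leaf i' hi']
  · by_cases h1 : u = (2 ^ h + i) / 2
    · exact .inr ⟨0, by simpa using h1⟩
    · left
      rw [update_of_ne (by omega), update_of_ne (by omega), update_of_ne (by omega),
        hT.node u hu hu']
  · rw [update_apply]
    split_ifs
    · exact hx
    · exact hT.le u hu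

/-- Updating the parent of `v` moves the defect one level up. -/
theorem TreeExcept.climb {h n v : ℕ} {T g : ℕ → ℕ} (hT : TreeExcept h n v T g)
    (hv : v < 2 * 2 ^ h) : TreeExcept h n (v / 2)
      (update T (v / 2) (T (2 * (v / 2)) + (1 - T (2 * (v / 2))) * T (2 * (v / 2) + 1))) g := by
  refine ⟨fun i hi => ?_, fun u hu hu' => ?_, fun u hu => ?_⟩
  · rw [update_of_ne (by omega), hT.leaf i hi]
  · by_cases h1 : u = v / 2
    · left
      subst h1
      rw [update_self, update_of_ne (by omega), update_of_ne (by omega)]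
    · by_cases h2 : u = v / 2 / 2
      · exact .inr ⟨0, by simpa using h2⟩
      · rcases hT.node u hu hu' with h3 | ⟨i, hi⟩
        · left
          rw [update_of_ne (by omega), update_of_ne (by omega), update_of_ne (by omega), h3]
        · right
          rcases i with _ | i
          · simp at hi
            omega
          · refine ⟨i, ?_⟩
            rw [hi, Nat.div_div_eq_div_mul, ← pow_succ']
  · rw [update_apply]
    split_ifs
    · have h1 := hT.le (2 * (v / 2)) (by omega)
      have h2 := hT.le (2 * (v / 2) + 1) (by omega)
      rcases Nat.eq_zero_or_pos (T (2 * (v / 2))) with h3 | h3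
      · rw [h3]
        omega
      · rw [show 1 - T (2 * (v / 2)) = 0 by omega]
        omega
    · exact hT.le u hu

/-! ### The layout of the memory -/

/-- The parameters of a run: `B` bounds the machine words, `wb` is the address of the word, and the
trees have `2 ^ h` leaves. -/
structure Params (B σ n wb h : ℕ) : Prop where
  n_le : n ≤ 2 ^ h
  wb_le : wb ≤ σ
  two_le : 2 < B
  addr_lt : σ + n + 2 * (n + 1) + (σ + 1) * (2 * 2 ^ h) < B

/-- The array `a` of length `len` is stored at address `base`. -/
def ArrAt (M : ℕ → ℕ) (base len : ℕ) (a : ℕ → ℕ) : Prop := ∀ k < len, M (base + k) = a k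

theorem ArrAt.store_self {M : ℕ → ℕ} {base len : ℕ} {a : ℕ → ℕ} (h : ArrAt M base len a)
    (k x : ℕ) : ArrAt (update M (base + k) x) base len (update a k x) := by
  intro k' hk'
  by_cases hk : k' = k
  · subst hk
    simp
  · rw [update_of_ne (by omega), update_of_ne hk, h k' hk']

theorem ArrAt.store_of_ne {M : ℕ → ℕ} {base len : ℕ} {a : ℕ → ℕ} (h : ArrAt M base len a)
    {addr : ℕ} (x : ℕ) (ha : addr < base ∨ base + len ≤ addr) :
    ArrAt (update M addr x) base len a := by
  intro k hk
  rw [update_of_ne (by omega), h k hk]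

/-- The trees with leaf entries `g 1, …, g σ` are stored from address `tb` on. -/
def TreesAt (M : ℕ → ℕ) (tb σ h n : ℕ) (g : ℕ → ℕ → ℕ) : Prop :=
  ∀ b, 1 ≤ b → b ≤ σ → Tree h n (fun v => M (tb + b * (2 * 2 ^ h) + v)) (g b)

theorem TreesAt.congr {M M' : ℕ → ℕ} {tb σ h n : ℕ} {g : ℕ → ℕ → ℕ} (hT : TreesAt M tb σ h n g)
    (hM : ∀ k, tb ≤ k → M' k = M k) : TreesAt M' tb σ h n g := by
  intro b hb hb'
  have : (fun v => M' (tb + b * (2 * 2 ^ h) + v)) = fun v => M (tb + b * (2 * 2 ^ h) + v) := by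
    funext v
    exact hM _ (by omega)
  rw [this]
  exact hT b hb hb'

theorem TreesAt.store_of_lt {M : ℕ → ℕ} {tb σ h n : ℕ} {g : ℕ → ℕ → ℕ} (hT : TreesAt M tb σ h n g)
    {addr : ℕ} (x : ℕ) (ha : addr < tb) : TreesAt (update M addr x) tb σ h n g :=
  hT.congr fun _ hk => update_of_ne (by omega) _ _

theorem Tree.congr {h n : ℕ} {T T' g : ℕ → ℕ} (hT : Tree h n T g)
    (h' : ∀ v < 2 * 2 ^ h, T' v = T v) : Tree h n T' g := by
  refine ⟨fun i hi => ?_, fun v hv hv' => ?_, fun v hv => ?_⟩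
  · rw [h' _ (by omega), hT.leaf i hi]
  · rw [h' _ (by omega), h' _ (by omega), h' _ (by omega), hT.node v hv hv']
  · rw [h' v hv]
    exact hT.le v hv

theorem TreesAt.set_tree {M M' : ℕ → ℕ} {tb σ h n : ℕ} {g : ℕ → ℕ → ℕ} (hT : TreesAt M tb σ h n g)
    {b : ℕ} {gb : ℕ → ℕ} (hb : Tree h n (fun v => M' (tb + b * (2 * 2 ^ h) + v)) gb)
    (hM : ∀ k, (k < tb + b * (2 * 2 ^ h) ∨ tb + b * (2 * 2 ^ h) + 2 * 2 ^ h ≤ k) → M' k = M k) :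
    TreesAt M' tb σ h n (update g b gb) := by
  intro b' h1 h2
  by_cases hbb : b' = b
  · subst hbb
    rwa [update_self]
  · rw [update_of_ne hbb]
    refine (hT b' h1 h2).congr fun v hv => hM _ ?_
    rcases lt_or_gt_of_ne hbb with hlt | hlt
    · left
      have := Nat.mul_le_mul_right (2 * 2 ^ h) (Nat.succ_le_of_lt hlt)
      rw [Nat.succ_mul] at this
      omega
    · right
      have := Nat.mul_le_mul_right (2 * 2 ^ h) (Nat.succ_le_of_lt hlt)
      rw [Nat.succ_mul] at this
      omega

/-- The registers that hold the parameters; no part of the main program changes them. -/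
structure Env (σ n wb h : ℕ) (s : State) : Prop where
  r0 : s.reg 0 = σ
  r1 : s.reg 1 = n
  r2 : s.reg 2 = wb
  r3 : s.reg 3 = 2 ^ h
  r4 : s.reg 4 = σ + n
  r5 : s.reg 5 = σ + n + (n + 1)
  r6 : s.reg 6 = σ + n + (n + 1) + (n + 1)
  r7 : s.reg 7 = 2 * 2 ^ h

theorem Env.congr {σ n wb h : ℕ} {s s' : State} (hs : Env σ n wb h s)
    (h' : ∀ r < 8, s'.reg r = s.reg r) : Env σ n wb h s' := by
  constructor
  all_goals rw [h' _ (by norm_num)]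
  exacts [hs.r0, hs.r1, hs.r2, hs.r3, hs.r4, hs.r5, hs.r6, hs.r7]

/-! ### Updating a tree -/

/-- With the address of a tree in register 20, a position in register 21 and an entry in
register 22, make this the entry of the leaf at that position and update the nodes above it. -/
def updateTree : Prog :=
  .seq (.assign 21 (.add (.var 3) (.var 21)))
  (.seq (.store (.add (.var 20) (.var 21)) (.var 22))
  (.loop (.sub (.var 21) (.const 1))
    (.seq (.assign 21 (.div (.var 21) (.const 2)))
      (.store (.add (.var 20) (.var 21))
        (.add (.load (.add (.var 20) (.mul (.const 2) (.var 21))))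
          (.mul (.sub (.const 1) (.load (.add (.var 20) (.mul (.const 2) (.var 21)))))
            (.load (.add (.add (.var 20) (.mul (.const 2) (.var 21))) (.const 1)))))))))

/-- In the tree of the symbol `b`, make `x` the entry of the leaf at position `k`. -/
def setLeaf (b k x : Expr) : Prog :=
  .seq (.assign 20 (.add (.var 6) (.mul b (.var 7))))
  (.seq (.assign 21 k) (.seq (.assign 22 x) updateTree))

/-- The constants in this and the following step bounds are not optimized. -/
theorem updateTree_spec {B σ n wb h : ℕ} (hp : Params B σ n wb h) {s : State}
    (hs : Env σ n wb h s) {b i x : ℕ} {g : ℕ → ℕ} (hb : b ≤ σ)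
    (h20 : s.reg 20 = σ + n + (n + 1) + (n + 1) + b * (2 * 2 ^ h)) (h21 : s.reg 21 = i)
    (h22 : s.reg 22 = x) (hi : i < n) (hx : x ≤ n)
    (hT : Tree h n (fun v => s.mem (s.reg 20 + v)) g) :
    Quiet B updateTree s (60 * (h + 2)) fun s' =>
      (∀ r < 20, s'.reg r = s.reg r) ∧
      Tree h n (fun v => s'.mem (s.reg 20 + v)) (update g i x) ∧
      ∀ k, (k < s.reg 20 ∨ s.reg 20 + 2 * 2 ^ h ≤ k) → s'.mem k = s.mem k := by
  have hin : i < 2 ^ h := hi.trans_le hp.n_le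
  have hB := hp.addr_lt
  have hB2 := hp.two_le
  have hnl := hp.n_le
  have hbs : b * (2 * 2 ^ h) + 2 * 2 ^ h ≤ (σ + 1) * (2 * 2 ^ h) := by
    have := Nat.mul_le_mul_right (2 * 2 ^ h) (Nat.succ_le_succ hb)
    rwa [Nat.succ_mul] at this
  set base := s.reg 20 with hbase
  have hbB : base + 2 * 2 ^ h < B := by omega
  let I : ℕ → State → Prop := fun j s' =>
    s'.reg 20 = base ∧ (∀ r < 20, s'.reg r = s.reg r) ∧
    2 ^ j ≤ s'.reg 21 ∧ s'.reg 21 < 2 * 2 ^ j ∧ j ≤ h ∧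
    TreeExcept h n (s'.reg 21) (fun v => s'.mem (base + v)) (update g i x) ∧
    ∀ k, (k < base ∨ base + 2 * 2 ^ h ≤ k) → s'.mem k = s.mem k
  have hloop := Quiet.loop (B := B) (K := 40) (e := .sub (.var 21) (.const 1))
    (p := (.seq (.assign 21 (.div (.var 21) (.const 2)))
      (.store (.add (.var 20) (.var 21))
        (.add (.load (.add (.var 20) (.mul (.const 2) (.var 21))))
          (.mul (.sub (.const 1) (.load (.add (.var 20) (.mul (.const 2) (.var 21)))))
            (.load (.add (.add (.var 20) (.mul (.const 2) (.var 21))) (.const 1)))))))) I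
    (by
      rintro s' ⟨h1, h2, h3, h4, h5, h6, h7⟩
      simp only [Expr.Fits, Expr.eval]
      omega)
    (by
      rintro j s' ⟨h1, h2, h3, h4, h5, h6, h7⟩
      have e2 : 2 ^ (j + 1) = 2 * 2 ^ j := by ring
      have hjh : 2 ^ (j + 1) ≤ 2 ^ h := Nat.pow_le_pow_right (by norm_num) h5
      have hj0 : 0 < 2 ^ j := by positivity
      rw [e2] at h3 h4 hjh
      set v := s'.reg 21 with hv
      refine ⟨?_, ?_, ?_⟩
      · simp only [Expr.Fits]
        omega
      · simp only [Expr.eval]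
        omega
      have hl := h6.le (2 * (v / 2)) (by omega)
      have hr := h6.le (2 * (v / 2) + 1) (by omega)
      have hc := (h6.climb (by omega)).le (v / 2) (by omega)
      rw [update_self] at hc
      have hmul : (1 - s'.mem (base + 2 * (v / 2))) * s'.mem (base + (2 * (v / 2) + 1)) ≤ n :=
        (Nat.le_add_left _ _).trans hc
      refine (Prog.Fits.quiet ?_).mono ?_ ?_
      · simp only [Prog.Fits, Prog.run, Expr.Fits, Expr.eval, update_self, h1, ← hv, ne_eq,
          Nat.reduceEqDiff, not_false_eq_true, update_of_ne, add_assoc]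
        omega
      · simp [Prog.steps, Expr.cost]
      · rintro s'' rfl
        simp only [I, Prog.run, Expr.eval, update_self, h1, ← hv, ne_eq,
          Nat.reduceEqDiff, not_false_eq_true, update_of_ne]
        refine ⟨trivial, fun r hr => ?_, by omega, by omega, by omega, ?_, fun k hk => ?_⟩
        · rw [update_of_ne (by omega), h2 r hr]
        · have h8 := h6.climb (by omega)
          convert h8 using 1
          funext u
          simp only [update_apply, add_assoc, add_right_inj]
        · rw [update_of_ne (by omega), h7 k hk])
  unfold updateTree
  refine Quiet.mono (Quiet.seq (K := 4)
    (R := (· = (Prog.assign 21 (.add (.var 3) (.var 21))).run s)) ?_ fun s' hs' =>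
    Quiet.seq (K := 5) (R := I h) ?_ fun s'' hs'' => hloop h s'' hs'') ?_ ?_
  · refine (Prog.Fits.quiet ?_).mono ?_ fun _ h => h
    · simp only [Prog.Fits, Expr.Fits, Expr.eval, h21, hs.r3]
      omega
    · simp [Prog.steps, Expr.cost]
  · subst hs'
    refine (Prog.Fits.quiet ?_).mono ?_ ?_
    · simp only [Prog.Fits, Prog.run, Expr.Fits, Expr.eval, h21, h22, hs.r3, update_self, ne_eq,
        Nat.reduceEqDiff, not_false_eq_true, update_of_ne, ← hbase]
      omega
    · simp [Prog.steps, Expr.cost]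
    · rintro s'' rfl
      simp only [I, Prog.run, Expr.eval, h21, h22, hs.r3, update_self, ne_eq,
        Nat.reduceEqDiff, not_false_eq_true, update_of_ne, ← hbase]
      refine ⟨trivial, fun r hr => ?_, by omega, by omega, le_rfl, ?_, fun k hk => ?_⟩
      · rw [update_of_ne (by omega)]
      · have h8 := hT.setLeaf hin hx
        convert h8 using 1
        funext u
        simp only [update_apply, add_right_inj]
      · rw [update_of_ne (by omega)]
  · simp only [Expr.cost]
    ring_nf
    omega
  · rintro s' ⟨h1, h2, h3, h4, h5, h6, h7⟩
    exact ⟨h2, h6.tree (by simp at h4; omega), h7⟩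

theorem setLeaf_spec {B σ n wb h : ℕ} (hp : Params B σ n wb h) {s : State}
    (hs : Env σ n wb h s) {rb rk b k x : ℕ} {e : Expr} {g : ℕ → ℕ → ℕ}
    (hrk : rk < 20) (hrb : s.reg rb = b) (hk : s.reg rk = k) (hb : 1 ≤ b) (hb' : b ≤ σ)
    (hkn : k < n) (hx : x ≤ n)
    (he : ∀ s' : State, (∀ r < 20, s'.reg r = s.reg r) → e.Fits B s' ∧ e.eval s' = x)
    (hT : TreesAt s.mem (σ + n + (n + 1) + (n + 1)) σ h n g) :
    Quiet B (setLeaf (.var rb) (.var rk) e) s (60 * (h + 2) + e.cost + 20) fun s' =>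
      (∀ r < 20, s'.reg r = s.reg r) ∧
      TreesAt s'.mem (σ + n + (n + 1) + (n + 1)) σ h n (update g b (update (g b) k x)) ∧
      ∀ a < σ + n + (n + 1) + (n + 1), s'.mem a = s.mem a := by
  have hB := hp.addr_lt
  have hB2 := hp.two_le
  have hnl := hp.n_le
  have hbs : b * (2 * 2 ^ h) + 2 * 2 ^ h ≤ (σ + 1) * (2 * 2 ^ h) := by
    have := Nat.mul_le_mul_right (2 * 2 ^ h) (Nat.succ_le_succ hb')
    rwa [Nat.succ_mul] at this
  have hbS : b ≤ b * (2 * 2 ^ h) := Nat.le_mul_of_pos_right _ (by positivity)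
  set base := σ + n + (n + 1) + (n + 1) + b * (2 * 2 ^ h) with hbase
  unfold setLeaf
  have hs₁ : (Prog.assign 20 (.add (.var 6) (.mul (.var rb) (.var 7)))).Fits B s := by
    simp only [Prog.Fits, Expr.Fits, Expr.eval, hrb, hs.r6, hs.r7]
    omega
  have h1 := hs₁.quiet
  refine Quiet.mono (h1.seq (K' := 60 * (h + 2) + e.cost + 10) fun s₁ hs₁ => ?_) ?_
    fun s' hs' => hs'
  swap
  · simp only [Prog.steps, Expr.cost]
    omega
  have hr₁ : s₁.reg = update s.reg 20 base := by
    rw [hs₁]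
    simp only [Prog.run, Expr.eval, hs.r6, hrb, hs.r7, hbase]
  have hm₁ : s₁.mem = s.mem := by rw [hs₁]; rfl
  have hlow₁ : ∀ r < 20, s₁.reg r = s.reg r := fun r hr => by rw [hr₁, update_of_ne (by omega)]
  have hs₂ : (Prog.assign 21 (.var rk)).Fits B s₁ := by
    simp only [Prog.Fits, Expr.Fits, hlow₁ rk hrk, hk]
    omega
  refine Quiet.mono (hs₂.quiet.seq (K' := 60 * (h + 2) + e.cost + 5) fun s₂ hs₂ => ?_) ?_
    fun s' hs' => hs'
  swap
  · simp only [Prog.steps, Expr.cost]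
    omega
  have hr₂ : s₂.reg = update s₁.reg 21 k := by
    rw [hs₂]
    simp only [Prog.run, Expr.eval, hlow₁ rk hrk, hk]
  have hm₂ : s₂.mem = s.mem := by rw [hs₂, ← hm₁]; rfl
  have hlow₂ : ∀ r < 20, s₂.reg r = s.reg r := fun r hr => by
    rw [hr₂, update_of_ne (by omega), hlow₁ r hr]
  obtain ⟨hef, hev⟩ := he s₂ hlow₂
  have hs₃ : (Prog.assign 22 e).Fits B s₂ := hef
  refine Quiet.mono (hs₃.quiet.seq (K' := 60 * (h + 2)) fun s₃ hs₃ => ?_) ?_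
    fun s' hs' => hs'
  swap
  · simp only [Prog.steps]
    omega
  have hr₃ : s₃.reg = update s₂.reg 22 x := by
    rw [hs₃]
    simp only [Prog.run, hev]
  have hm₃ : s₃.mem = s.mem := by rw [hs₃, ← hm₂]; rfl
  have hlow₃ : ∀ r < 20, s₃.reg r = s.reg r := fun r hr => by
    rw [hr₃, update_of_ne (by omega), hlow₂ r hr]
  have h20 : s₃.reg 20 = base := by
    rw [hr₃, update_of_ne (by norm_num), hr₂, update_of_ne (by norm_num), hr₁, update_self]
  have h21 : s₃.reg 21 = k := by
    rw [hr₃, update_of_ne (by norm_num), hr₂, update_self]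
  have h22 : s₃.reg 22 = x := by rw [hr₃, update_self]
  refine (updateTree_spec hp (hs.congr fun r hr => hlow₃ r (by omega)) hb' h20 h21 h22 hkn hx
    (g := g b) ?_).mono le_rfl ?_
  · rw [h20, hm₃]
    exact hT b hb hb'
  · rintro s' ⟨h4, h5, h6⟩
    rw [h20] at h5 h6
    refine ⟨fun r hr => (h4 r hr).trans (hlow₃ r hr), hT.set_tree h5 ?_, fun a ha => ?_⟩
    · intro a ha
      rw [h6 a ha, hm₃]
    · rw [h6 a (by omega), hm₃]

/-! ### The configuration in memory -/

/-- The entries at the leaves of the tree of the symbol `b`: its positions, counted from 1. -/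
def leafEntry (n : ℕ) (w : ℕ → ℕ) (b i : ℕ) : ℕ := if i < n ∧ w i = b then i + 1 else 0

/-- The root of the tree of the symbol `b` shows the first occurrence of `b`, or 0 if there is
none. -/
theorem TreesAt.root {M : ℕ → ℕ} {tb σ h n b : ℕ} {w : ℕ → ℕ}
    (hT : TreesAt M tb σ h n (leafEntry n w)) (hn : n ≤ 2 ^ h) (hb : 1 ≤ b) (hb' : b ≤ σ) :
    (M (tb + b * (2 * 2 ^ h) + 1) = 0 ∧ ∀ k < n, w k ≠ b) ∨
    ∃ i < n, M (tb + b * (2 * 2 ^ h) + 1) = i + 1 ∧ IsLeast {k | k < n ∧ w k = b} i := by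
  obtain ⟨h1, h2⟩ := (hT b hb hb').root
  simp only [leafEntry] at h1 h2
  by_cases h0 : M (tb + b * (2 * 2 ^ h) + 1) = 0
  · left
    refine ⟨h0, fun k hk hwk => ?_⟩
    simpa [hk, hwk] using h1 h0 k (by omega)
  · right
    obtain ⟨i, hi, hi', hmin⟩ := h2 h0
    split_ifs at hi' with hc
    · refine ⟨i, hc.1, hi'.symm, hc, fun k hk => ?_⟩
      by_contra hlt
      simpa [hk.1, hk.2] using hmin k (by omega)
    · exact absurd hi'.symm h0

/-- The state `s` holds the configuration `c`. In the array of focus pointers 0 stands for the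
identity, as the memory is 0 at the beginning. -/
structure Rep (σ n wb h : ℕ) (c : Config) (s : State) : Prop where
  env : Env σ n wb h s
  word : ArrAt s.mem wb n c.word
  jump : ∃ j, ArrAt s.mem (σ + n) (n + 1) j ∧ ∀ m ≤ n, j m + (1 - j m) * m = c.jump m
  start : ArrAt s.mem (σ + n + (n + 1)) n c.start
  trees : TreesAt s.mem (σ + n + (n + 1) + (n + 1)) σ h n (leafEntry n c.word)
  word_pos : ∀ k < n, 1 ≤ c.word k
  word_le : ∀ k < n, c.word k ≤ σ
  start_le : ∀ k < n, c.start k ≤ σ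
  jump_le : ∀ m ≤ n, c.jump m ≤ n

theorem Rep.congr {σ n wb h : ℕ} {c : Config} {s s' : State} (hs : Rep σ n wb h c s)
    (hr : ∀ r < 8, s'.reg r = s.reg r) (hm : s'.mem = s.mem) : Rep σ n wb h c s' where
  env := hs.env.congr hr
  word := hm ▸ hs.word
  jump := hm ▸ hs.jump
  start := hm ▸ hs.start
  trees := hm ▸ hs.trees
  word_pos := hs.word_pos
  word_le := hs.word_le
  start_le := hs.start_le
  jump_le := hs.jump_le

/-- The root of the tree of the symbol in register `r`: its first position (counted from 1), or 0
if the symbol does not occur. -/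
def rootOf (r : ℕ) : Expr := .load (.add (.add (.var 6) (.mul (.var r) (.var 7))) (.const 1))

theorem Rep.rootOf {B σ n wb h : ℕ} (hp : Params B σ n wb h) {c : Config} {s : State}
    (hs : Rep σ n wb h c s) {r b : ℕ} (hr : s.reg r = b) (hb : 1 ≤ b) (hb' : b ≤ σ) :
    (rootOf r).Fits B s ∧
    (((rootOf r).eval s = 0 ∧ ∀ k < n, c.word k ≠ b) ∨
      ∃ i < n, (rootOf r).eval s = i + 1 ∧ IsLeast {k | k < n ∧ c.word k = b} i) := by
  have hB := hp.addr_lt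
  have hB2 := hp.two_le
  have hbs : b * (2 * 2 ^ h) + 2 * 2 ^ h ≤ (σ + 1) * (2 * 2 ^ h) := by
    have := Nat.mul_le_mul_right (2 * 2 ^ h) (Nat.succ_le_succ hb')
    rwa [Nat.succ_mul] at this
  have hbS : b ≤ b * (2 * 2 ^ h) := Nat.le_mul_of_pos_right _ (by positivity)
  have h1 := hs.trees.root hp.n_le hb hb'
  have hpos : 0 < 2 ^ h := by positivity
  simp only [SwapGraph.rootOf, Expr.Fits, Expr.eval, hs.env.r6, hs.env.r7, hr]
  refine ⟨⟨by omega, ?_⟩, h1⟩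
  rcases h1 with h1 | ⟨i, h1, h2, -⟩ <;> omega

/-! ### The first change of symbol -/

/-- Put into register 9 the least first position of a symbol other than that of position 0, or the
length of the word if there is no other symbol. -/
def findChange : Prog :=
  .seq (.assign 9 (.var 1)) (.seq (.assign 16 (.var 0)) (.seq (.assign 17 (.load (.var 2)))
    (.loop (.var 16)
      (.seq (.assign 18 (rootOf 16))
      (.seq
        (.ite (.var 18)
          (.ite (.add (.sub (.var 16) (.var 17)) (.sub (.var 17) (.var 16)))
            (.ite (.sub (.add (.var 9) (.const 1)) (.var 18))
              (.assign 9 (.sub (.var 18) (.const 1))) .skip) .skip) .skip)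
        (.assign 16 (.sub (.var 16) (.const 1))))))))

theorem findChange_spec {B σ n wb h : ℕ} (hp : Params B σ n wb h) {c : Config} {s : State}
    (hs : Rep σ n wb h c s) (hn : 1 ≤ n) :
    Quiet B findChange s (σ * 50 + 20) fun s' =>
      (∀ r < 9, s'.reg r = s.reg r) ∧ s'.mem = s.mem ∧ FirstChange n c.word (s'.reg 9) := by
  have hB := hp.addr_lt
  have hB2 := hp.two_le
  have hwb := hp.wb_le
  have hσ : σ ≤ (σ + 1) * (2 * 2 ^ h) :=
    (Nat.le_succ σ).trans (Nat.le_mul_of_pos_right _ (by positivity))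
  have hw0 := hs.word_pos 0 hn
  have hw0' := hs.word_le 0 hn
  have hload : s.mem wb = c.word 0 := hs.word 0 hn
  let I : ℕ → State → Prop := fun b s' =>
    s'.reg 16 = b ∧ s'.reg 17 = c.word 0 ∧ b ≤ σ ∧
    (∀ r < 9, s'.reg r = s.reg r) ∧ s'.mem = s.mem ∧ s'.reg 9 ≤ n ∧
    (∀ k < n, b < c.word k → c.word k ≠ c.word 0 → s'.reg 9 ≤ k) ∧
    (s'.reg 9 < n → c.word (s'.reg 9) ≠ c.word 0)
  unfold findChange
  have hinit : Prog.Fits B (.seq (.assign 9 (.var 1)) (.seq (.assign 16 (.var 0))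
      (.assign 17 (.load (.var 2))))) s := by
    simp only [Prog.Fits, Prog.run, Expr.Fits, Expr.eval, ne_eq, Nat.reduceEqDiff,
      not_false_eq_true, update_of_ne, hs.env.r0, hs.env.r1, hs.env.r2, hload,
      OfNat.zero_ne_ofNat]
    refine ⟨by omega, by omega, by omega, by omega⟩
  have h1 := Prog.Fits.quiet (p := .assign 9 (.var 1)) hinit.1
  have h2 := Prog.Fits.quiet (p := .assign 16 (.var 0)) hinit.2.1
  have h3 := Prog.Fits.quiet (p := .assign 17 (.load (.var 2))) hinit.2.2
  have hloop := Quiet.loop (B := B) (K := 48) (e := .var 16) (p := .seq (.assign 18 (rootOf 16))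
      (.seq
        (.ite (.var 18)
          (.ite (.add (.sub (.var 16) (.var 17)) (.sub (.var 17) (.var 16)))
            (.ite (.sub (.add (.var 9) (.const 1)) (.var 18))
              (.assign 9 (.sub (.var 18) (.const 1))) .skip) .skip) .skip)
        (.assign 16 (.sub (.var 16) (.const 1))))) I
    (by
      rintro s' ⟨h16, -⟩
      exact ⟨by simp only [Expr.Fits, h16]; omega, h16⟩)
    (by
      rintro b s' ⟨h16, h17, hbσ, hlow, hmem, h9, hmin, hne⟩
      have hs' : Rep σ n wb h c s' := hs.congr (fun r hr => hlow r (by omega)) hmem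
      obtain ⟨hfit, hroot⟩ := hs'.rootOf hp h16 (by omega) hbσ
      refine ⟨?_, ?_, ?_⟩
      · simp only [Expr.Fits, h16]
        omega
      · simp only [Expr.eval, h16]
        omega
      set x := (rootOf 16).eval s' with hx
      have hxB : x < B := by
        rcases hroot with ⟨h1, -⟩ | ⟨i, h1, h2, -⟩ <;> omega
      set F := s'.reg 9 with hF
      refine (Prog.Fits.quiet ?_).mono ?_ ?_
      · simp only [Prog.Fits, Prog.run, Expr.Fits, Expr.eval, ne_eq, Nat.reduceEqDiff,
          not_false_eq_true, update_of_ne, update_self, h16, h17, ← hx, ← hF]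
        refine ⟨hfit, ?_⟩
        split_ifs <;> simp [h16] <;> omega
      · simp [Prog.steps, Expr.cost, rootOf]
      · rintro s'' rfl
        simp only [I, Prog.run, Expr.eval, ne_eq, Nat.reduceEqDiff,
          not_false_eq_true, update_of_ne, update_self, h16, h17, ← hx, ← hF]
        -- the new value of register 9
        have key : ∀ F', ((x ≠ 0 ∧ b + 1 ≠ c.word 0 ∧ x ≤ F ∧ F' = x - 1) ∨
            (¬ (x ≠ 0 ∧ b + 1 ≠ c.word 0 ∧ x ≤ F) ∧ F' = F)) → F' ≤ n ∧
            (∀ k < n, b < c.word k → c.word k ≠ c.word 0 → F' ≤ k) ∧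
            (F' < n → c.word F' ≠ c.word 0) := by
          rintro F' (⟨h1, h2, h3, rfl⟩ | ⟨h1, rfl⟩)
          · obtain ⟨h0, -⟩ | ⟨i, hi, hxi, hil⟩ := hroot
            · exact absurd h0 h1
            · rw [hxi, Nat.add_sub_cancel]
              refine ⟨hi.le, fun k hk hbk hk0 => ?_, fun _ => ?_⟩
              · by_cases hkb : c.word k = b + 1
                · exact hil.2 ⟨hk, hkb⟩
                · have := hmin k hk (by omega) hk0
                  omega
              · rw [hil.1.2]
                exact h2
          · refine ⟨h9, fun k hk hbk hk0 => ?_, hne⟩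
            by_cases hkb : c.word k = b + 1
            · obtain ⟨-, h0⟩ | ⟨i, hi, hxi, hil⟩ := hroot
              · exact absurd hkb (h0 k hk)
              · have := hil.2 ⟨hk, hkb⟩
                have : ¬ (x ≤ F) := fun h => h1 ⟨by omega, hkb ▸ hk0, h⟩
                omega
            · exact hmin k hk (by omega) hk0
        split_ifs <;> simp only [ne_eq, Nat.reduceEqDiff,
          not_false_eq_true, update_of_ne, update_self, h16, h17, ← hF, hmem] <;>
          refine ⟨by omega, trivial, by omega, fun r hr => ?_, trivial, key _ (by omega)⟩ <;>
          simp (discharger := omega) only [update_of_ne, hlow r hr])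
  refine Quiet.mono (h1.seq fun s₁ hs₁ => Quiet.seq (hs₁ ▸ h2) fun s₂ hs₂ =>
    Quiet.seq (hs₂ ▸ hs₁ ▸ h3) fun s₃ hs₃ => hloop σ s₃ ?_) ?_ ?_
  · subst hs₃ hs₂ hs₁
    simp only [I, Prog.run, Expr.eval, ne_eq, Nat.reduceEqDiff,
      not_false_eq_true, update_of_ne, update_self, hs.env.r0, hs.env.r1, hs.env.r2, hload,
      OfNat.zero_ne_ofNat]
    refine ⟨trivial, trivial, le_rfl, fun r hr => ?_, trivial, le_rfl, fun k hk hk' => ?_, fun h => ?_⟩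
    · simp (discharger := omega) only [update_of_ne]
    · have := hs.word_le k hk
      omega
    · omega
  · simp [Prog.steps, Expr.cost]
    omega
  · rintro s' ⟨-, -, -, h1, h2, h3, h4, h5⟩
    refine ⟨h1, h2, ?_, h3, fun k hk => ?_, h5⟩
    · by_contra h0
      have h0 : s'.reg 9 = 0 := by omega
      rw [h0] at h5
      exact h5 (by omega) rfl
    · by_contra hne
      have := h4 k (by omega) (hs.word_pos k (by omega)) hne
      omega

/-! ### The next symbol of a level -/

/-- With a level in register 10, the symbol with which it began in register 12 and a lower bound
in register 13, put the least candidate of the level above that bound into register 14, and some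
other candidate, if there is one, into register 15 (otherwise 0). -/
def chooseNext : Prog :=
  .seq (.assign 14 (.const 0)) (.seq (.assign 15 (.const 0)) (.seq (.assign 16 (.var 0))
    (.loop (.sub (.var 16) (.var 13))
      (.seq (.assign 18 (rootOf 16))
      (.seq
        (.ite (.var 18)
          (.ite (.sub (.add (.var 10) (.const 1)) (.var 18))
            (.ite (.add (.sub (.var 16) (.var 12)) (.sub (.var 12) (.var 16)))
              (.seq (.assign 15 (.var 14)) (.assign 14 (.var 16))) .skip) .skip) .skip)
        (.assign 16 (.sub (.var 16) (.const 1))))))))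

theorem chooseNext_spec {B σ n wb h : ℕ} (hp : Params B σ n wb h) {c : Config} {s : State}
    (hs : Rep σ n wb h c s) {m : ℕ} (hm : m < n) (h10 : s.reg 10 = m)
    (h12 : s.reg 12 = startSym c.word (c.start m) m)
    (h13 : s.reg 13 = if c.start m = 0 then 0 else c.word m)
    (hne : (cand c.word (c.start m) m).Nonempty) :
    Quiet B chooseNext s (σ * 60 + 20) fun s' =>
      (∀ r < 14, s'.reg r = s.reg r) ∧ s'.mem = s.mem ∧
      IsLeast (cand c.word (c.start m) m : Set ℕ) (s'.reg 14) ∧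
      (s'.reg 15 = 0 ↔ cand c.word (c.start m) m = {s'.reg 14}) ∧ s'.reg 15 ≤ σ := by
  have hB := hp.addr_lt
  have hB2 := hp.two_le
  have hwb := hp.wb_le
  have hσ : σ ≤ (σ + 1) * (2 * 2 ^ h) :=
    (Nat.le_succ σ).trans (Nat.le_mul_of_pos_right _ (by positivity))
  set lo := if c.start m = 0 then 0 else c.word m with hlo
  set st := startSym c.word (c.start m) m with hst
  set C := cand c.word (c.start m) m with hC
  have hloσ : lo ≤ σ := by
    rw [hlo]
    split_ifs
    · omega
    · exact hs.word_le m hm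
  have hstσ : st ≤ σ := by
    rw [hst, startSym]
    split_ifs
    · exact hs.word_le m hm
    · exact hs.start_le m hm
  have hmemC : ∀ b, b ∈ C ↔ (∃ k < m, c.word k = b) ∧ lo < b ∧ b ≠ st := fun b => mem_cand
  have hCσ : ∀ b ∈ C, b ≤ σ := by
    intro b hb
    obtain ⟨⟨k, hk, rfl⟩, -⟩ := (hmemC b).1 hb
    exact hs.word_le k (by omega)
  let I : ℕ → State → Prop := fun i s' =>
    s'.reg 16 = lo + i ∧ lo + i ≤ σ ∧ (∀ r < 14, s'.reg r = s.reg r) ∧ s'.mem = s.mem ∧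
    s'.reg 14 ≤ σ ∧ s'.reg 15 ≤ σ ∧
    ((s'.reg 14 = 0 ∧ s'.reg 15 = 0 ∧ ∀ b ∈ C, b ≤ lo + i) ∨
      (s'.reg 14 ∈ C ∧ lo + i < s'.reg 14 ∧ (∀ b ∈ C, lo + i < b → s'.reg 14 ≤ b) ∧
        (s'.reg 15 = 0 → ∀ b ∈ C, lo + i < b → b = s'.reg 14) ∧
        (s'.reg 15 ≠ 0 → s'.reg 15 ∈ C ∧ s'.reg 15 ≠ s'.reg 14)))
  unfold chooseNext
  have hinit : Prog.Fits B (.seq (.assign 14 (.const 0)) (.seq (.assign 15 (.const 0))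
      (.assign 16 (.var 0)))) s := by
    simp only [Prog.Fits, Prog.run, Expr.Fits, Expr.eval, ne_eq,
      not_false_eq_true, update_of_ne, hs.env.r0, OfNat.zero_ne_ofNat]
    omega
  have h1 := Prog.Fits.quiet (p := .assign 14 (.const 0)) hinit.1
  have h2 := Prog.Fits.quiet (p := .assign 15 (.const 0)) hinit.2.1
  have h3 := Prog.Fits.quiet (p := .assign 16 (.var 0)) hinit.2.2
  have hloop := Quiet.loop (B := B) (K := 50) (e := .sub (.var 16) (.var 13))
    (p := .seq (.assign 18 (rootOf 16))
      (.seq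
        (.ite (.var 18)
          (.ite (.sub (.add (.var 10) (.const 1)) (.var 18))
            (.ite (.add (.sub (.var 16) (.var 12)) (.sub (.var 12) (.var 16)))
              (.seq (.assign 15 (.var 14)) (.assign 14 (.var 16))) .skip) .skip) .skip)
        (.assign 16 (.sub (.var 16) (.const 1))))) I
    (by
      rintro s' ⟨h16, -, hlow, -⟩
      have h13' := (hlow 13 (by norm_num)).trans h13
      simp only [Expr.Fits, Expr.eval, h16, h13']
      omega)
    (by
      rintro i s' ⟨h16, hbσ, hlow, hmem, h14, h15, hinv⟩
      have h13' := (hlow 13 (by norm_num)).trans h13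
      have h12' := (hlow 12 (by norm_num)).trans h12
      have h10' := (hlow 10 (by norm_num)).trans h10
      have hs' : Rep σ n wb h c s' := hs.congr (fun r hr => hlow r (by omega)) hmem
      set b := lo + (i + 1) with hb
      obtain ⟨hfit, hroot⟩ := hs'.rootOf hp h16 (by omega) hbσ
      refine ⟨?_, ?_, ?_⟩
      · simp only [Expr.Fits, h16, h13']
        omega
      · simp only [Expr.eval, h16, h13']
        omega
      set x := (rootOf 16).eval s' with hx
      have hxB : x < B := by
        rcases hroot with ⟨h1, -⟩ | ⟨i, h1, h2, -⟩ <;> omega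
      set y := s'.reg 14 with hy
      set z := s'.reg 15 with hz
      refine (Prog.Fits.quiet ?_).mono ?_ ?_
      · simp only [Prog.Fits, Prog.run, Expr.Fits, Expr.eval, ne_eq, Nat.reduceEqDiff,
          not_false_eq_true, update_of_ne, update_self, h16, h10', h12', ← hx, ← hy]
        refine ⟨hfit, ?_⟩
        split_ifs <;> simp [h16] <;> omega
      · simp [Prog.steps, Expr.cost, rootOf]
      · rintro s'' rfl
        have hbC : b ∈ C ↔ x ≠ 0 ∧ x ≤ m ∧ b ≠ st := by
          rw [hmemC]
          obtain ⟨h0, h1⟩ | ⟨k, hk, hxk, hkl⟩ := hroot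
          · refine ⟨?_, fun h => absurd h0 h.1⟩
            rintro ⟨⟨k, hk, hkb⟩, -⟩
            exact absurd hkb (h1 k (by omega))
          · constructor
            · rintro ⟨⟨k', hk', hkb⟩, h5, h6⟩
              have := hkl.2 ⟨by omega, hkb⟩
              exact ⟨by omega, by omega, h6⟩
            · rintro ⟨h4, h5, h6⟩
              exact ⟨⟨k, by omega, hkl.1.2⟩, by omega, h6⟩
        simp only [I, Prog.run, Expr.eval, ne_eq, Nat.reduceEqDiff,
          not_false_eq_true, update_of_ne, update_self, h16, h10', h12', ← hx, ← hy]
        -- the new values of the registers 14 and 15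
        have key : ∀ y' z', ((b ∈ C ∧ y' = b ∧ z' = y) ∨ (b ∉ C ∧ y' = y ∧ z' = z)) →
            y' ≤ σ ∧ z' ≤ σ ∧ ((y' = 0 ∧ z' = 0 ∧ ∀ b ∈ C, b ≤ lo + i) ∨
            (y' ∈ C ∧ lo + i < y' ∧ (∀ b ∈ C, lo + i < b → y' ≤ b) ∧
              (z' = 0 → ∀ b ∈ C, lo + i < b → b = y') ∧ (z' ≠ 0 → z' ∈ C ∧ z' ≠ y'))) := by
          rintro y' z' (⟨h4, rfl, rfl⟩ | ⟨h4, rfl, rfl⟩)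
          · refine ⟨by omega, h14, .inr ⟨h4, by omega, fun b' _ h => by omega, ?_, ?_⟩⟩
            · intro hy0 b' hb' hlt
              rcases hinv with ⟨-, -, h5⟩ | ⟨-, h5, -⟩
              · have := h5 b' hb'
                omega
              · omega
            · intro hy0
              rcases hinv with ⟨h5, -⟩ | ⟨h5, h6, -⟩
              · exact absurd h5 hy0
              · exact ⟨h5, by omega⟩
          · have hlt : ∀ b' ∈ C, lo + i < b' → b < b' := by
              intro b' hb' h5
              have : b' ≠ b := fun h => h4 (h ▸ hb')
              omega
            refine ⟨h14, h15, ?_⟩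
            rcases hinv with ⟨h5, h6, h7⟩ | ⟨h5, h6, h7, h8, h9⟩
            · refine .inl ⟨h5, h6, fun b' hb' => ?_⟩
              have := h7 b' hb'
              have : b' ≠ b := fun h => h4 (h ▸ hb')
              omega
            · exact .inr ⟨h5, by omega, fun b' hb' h => h7 b' hb' (hlt b' hb' h),
                fun h0 b' hb' h => h8 h0 b' hb' (hlt b' hb' h), h9⟩
        split_ifs <;> simp only [ne_eq, Nat.reduceEqDiff,
          not_false_eq_true, update_of_ne, update_self, h16, ← hy, ← hz, hmem] <;>
          refine ⟨by omega, by omega, fun r hr => ?_, trivial, key _ _ (by rw [hbC]; omega)⟩ <;>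
          simp (discharger := omega) only [update_of_ne, hlow r hr])
  refine Quiet.mono (h1.seq fun s₁ hs₁ => Quiet.seq (hs₁ ▸ h2) fun s₂ hs₂ =>
    Quiet.seq (hs₂ ▸ hs₁ ▸ h3) fun s₃ hs₃ => hloop (σ - lo) s₃ ?_) ?_ ?_
  · subst hs₃ hs₂ hs₁
    simp only [I, Prog.run, Expr.eval, ne_eq, Nat.reduceEqDiff,
      not_false_eq_true, update_of_ne, update_self, hs.env.r0, OfNat.zero_ne_ofNat]
    refine ⟨by omega, by omega, fun r hr => ?_, trivial, by omega, by omega,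
      .inl ⟨trivial, trivial, fun b hb => ?_⟩⟩
    · simp (discharger := omega) only [update_of_ne]
    · have := hCσ b hb
      omega
  · simp only [Prog.steps, Expr.cost]
    have : (σ - lo) * (50 + (1 + 1 + 1) + 1) ≤ σ * (50 + (1 + 1 + 1) + 1) :=
      Nat.mul_le_mul_right _ (by omega)
    omega
  · rintro s' ⟨-, -, h1, h2, h3, h4, h5⟩
    have hlb : ∀ b ∈ C, lo + 0 < b := fun b hb => ((hmemC b).1 hb).2.1
    rcases h5 with ⟨-, -, h5⟩ | ⟨h5, h6, h7, h8, h9⟩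
    · obtain ⟨b, hb⟩ := hne
      have := h5 b hb
      have := hlb b hb
      omega
    · refine ⟨h1, h2, ⟨h5, fun b hb => h7 b hb (hlb b hb)⟩, ⟨fun h0 => ?_, fun h0 => ?_⟩, h4⟩
      · ext b
        rw [Finset.mem_singleton]
        exact ⟨fun hb => h8 h0 b hb (hlb b hb), fun hb => hb ▸ h5⟩
      · by_contra hz
        obtain ⟨h10, h11⟩ := h9 hz
        rw [h0, Finset.mem_singleton] at h10
        exact h11 h10

/-! ### One step of the enumeration -/

/-- The expression for the focus pointer of the level in register `r`. -/
def jumpOf (r : Expr) : Expr :=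
  .add (.load (.add (.var 4) r)) (.mul (.sub (.const 1) (.load (.add (.var 4) r))) r)

/-- Take the focus pointer away from the level in register 9, and load the data of the level in
register 10: its symbol (register 11), the symbol with which it began (register 12) and the lower
bound for its next symbol (register 13). -/
def openLevel : Prog :=
  .seq (.store (.add (.var 4) (.var 9)) (.const 0))
  (.seq (.assign 11 (.load (.add (.var 2) (.var 10))))
  (.seq (.assign 12 (.load (.add (.var 5) (.var 10))))
    (.ite (.var 12) (.assign 13 (.var 11))
      (.seq (.assign 13 (.const 0)) (.assign 12 (.var 11))))))

/-- Exchange the symbol in register 14, which is at the position in register 18, with the symbol in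
register 11, which is at the position in register 10. -/
def exchange : Prog :=
  .seq (.store (.add (.var 2) (.var 18)) (.var 11))
  (.seq (.store (.add (.var 2) (.var 10)) (.var 14))
  (.seq (setLeaf (.var 14) (.var 18) (.const 0))
  (.seq (setLeaf (.var 14) (.var 10) (.add (.var 10) (.const 1)))
  (.seq (setLeaf (.var 11) (.var 10) (.const 0))
    (setLeaf (.var 11) (.var 18) (.add (.var 18) (.const 1)))))))

/-- Record whether the level in register 10 is in progress or exhausted. -/
def closeLevel : Prog :=
  .ite (.var 15) (.store (.add (.var 5) (.var 10)) (.var 12))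
    (.seq (.store (.add (.var 5) (.var 10)) (.const 0))
    (.seq (.store (.add (.var 4) (.var 10)) (jumpOf (.add (.var 10) (.const 1))))
      (.store (.add (.var 4) (.add (.var 10) (.const 1))) (.const 0))))

/-- One step of the enumeration; register 8 is cleared when there is none left. -/
def enumStep : Prog :=
  .seq findChange
  (.seq (.assign 10 (jumpOf (.var 9)))
    (.ite (.sub (.var 1) (.var 10))
      (.seq openLevel
      (.seq chooseNext
      (.seq (.assign 18 (.sub (rootOf 14) (.const 1)))
      (.seq (.out (.add (.var 18) (.const 1)) (.add (.var 10) (.const 1)))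
      (.seq exchange closeLevel)))))
      (.assign 8 (.const 0))))

theorem Rep.jumpOf {B σ n wb h : ℕ} (hp : Params B σ n wb h) {c : Config} {s : State}
    (hs : Rep σ n wb h c s) {r : Expr} (hr : r.Fits B s) {m : ℕ} (hm : r.eval s = m)
    (hmn : m ≤ n) : (jumpOf r).Fits B s ∧ (jumpOf r).eval s = c.jump m := by
  obtain ⟨j, hj, hj'⟩ := hs.jump
  have hB := hp.addr_lt
  have h1 := hj m (by omega)
  have h2 := hj' m hmn
  have h3 := hs.jump_le m hmn
  simp only [SwapGraph.jumpOf, Expr.Fits, Expr.eval, hm, hs.env.r4, h1, h2, and_true]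
  have h4 : (1 - j m) * m ≤ c.jump m := by omega
  have h5 : j m ≤ c.jump m := by omega
  refine ⟨⟨⟨by omega, hr, by omega⟩, by omega⟩, ⟨⟨by omega, ⟨by omega, hr, by omega⟩, by omega⟩,
    hr, by omega⟩, by omega⟩

theorem openLevel_spec {B σ n wb h : ℕ} (hp : Params B σ n wb h) {c : Config} {s : State}
    (hs : Rep σ n wb h c s) {f m : ℕ} (hf : f ≤ n) (hm : m < n) (h9 : s.reg 9 = f)
    (h10 : s.reg 10 = m) :
    Quiet B openLevel s 30 fun s' =>
      Rep σ n wb h { c with jump := update c.jump f f } s' ∧ (∀ r < 11, s'.reg r = s.reg r) ∧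
      s'.reg 11 = c.word m ∧ s'.reg 12 = startSym c.word (c.start m) m ∧
      s'.reg 13 = if c.start m = 0 then 0 else c.word m := by
  have hB := hp.addr_lt
  have hB2 := hp.two_le
  have hwb := hp.wb_le
  have hσ : σ ≤ (σ + 1) * (2 * 2 ^ h) :=
    (Nat.le_succ σ).trans (Nat.le_mul_of_pos_right _ (by positivity))
  have hw := hs.word_le m hm
  have hst := hs.start_le m hm
  have hmw : update s.mem (σ + n + f) 0 (wb + m) = c.word m := by
    rw [update_of_ne (by omega), hs.word m hm]
  have hms : update s.mem (σ + n + f) 0 (σ + n + (n + 1) + m) = c.start m := by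
    rw [update_of_ne (by omega), hs.start m hm]
  refine (Prog.Fits.quiet ?_).mono ?_ ?_
  · simp only [openLevel, Prog.Fits, Prog.run, Expr.Fits, Expr.eval, ne_eq, Nat.reduceEqDiff,
      not_false_eq_true, update_of_ne, update_self, hs.env.r2, hs.env.r4, hs.env.r5, h9, h10,
      hmw, hms]
    omega
  · simp [openLevel, Prog.steps, Expr.cost]
  · rintro s' rfl
    have hmem : (openLevel.run s).mem = update s.mem (σ + n + f) 0 := by
      simp only [openLevel, Prog.run, Expr.eval, ne_eq, Nat.reduceEqDiff,
        not_false_eq_true, update_of_ne, update_self, hs.env.r2, hs.env.r4, hs.env.r5, h9, h10,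
        hmw, hms]
      split_ifs <;> rfl
    have hreg : ∀ r < 11, (openLevel.run s).reg r = s.reg r := by
      intro r hr
      simp only [openLevel, Prog.run, Expr.eval, ne_eq, Nat.reduceEqDiff,
        not_false_eq_true, update_of_ne, update_self, hs.env.r2, hs.env.r4, hs.env.r5, h9, h10,
        hmw, hms]
      split_ifs <;> simp (discharger := omega) only [update_of_ne]
    refine ⟨⟨hs.env.congr fun r hr => hreg r (by omega), ?_, ?_, ?_, ?_, hs.word_pos, hs.word_le,
      hs.start_le, ?_⟩, hreg, ?_⟩
    · rw [hmem]
      exact hs.word.store_of_ne _ (by omega)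
    · obtain ⟨j, hj, hj'⟩ := hs.jump
      rw [hmem]
      refine ⟨update j f 0, hj.store_self f 0, fun k hk => ?_⟩
      by_cases hkf : k = f
      · subst hkf
        simp
      · simp only [update_of_ne hkf]
        exact hj' k hk
    · rw [hmem]
      exact hs.start.store_of_ne _ (by omega)
    · rw [hmem]
      exact hs.trees.store_of_lt _ (by omega)
    · intro k hk
      by_cases hkf : k = f
      · subst hkf
        simpa using hk
      · simp only [update_of_ne hkf]
        exact hs.jump_le k hk
    · simp only [openLevel, Prog.run, Expr.eval, ne_eq, Nat.reduceEqDiff,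
        not_false_eq_true, update_of_ne, update_self, hs.env.r2, hs.env.r4, hs.env.r5, h9, h10,
        hmw, hms, startSym]
      split_ifs <;> simp

/-- The tree of each of the two symbols loses one position and gains the other. -/
theorem exchange_spec {B σ n wb h : ℕ} (hp : Params B σ n wb h) {c : Config} {s : State}
    (hs : Rep σ n wb h c s) {i m : ℕ} (him : i < m) (hm : m < n) (hne : c.word i ≠ c.word m)
    (h10 : s.reg 10 = m) (h18 : s.reg 18 = i) (h11 : s.reg 11 = c.word m)
    (h14 : s.reg 14 = c.word i) :
    Quiet B exchange s (240 * (h + 2) + 200) fun s' =>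
      Rep σ n wb h { c with word := c.word ∘ Equiv.swap i m } s' ∧
      ∀ r < 20, s'.reg r = s.reg r := by
  have hB := hp.addr_lt
  have hB2 := hp.two_le
  have hwb := hp.wb_le
  have hnl := hp.n_le
  have hσ : σ ≤ (σ + 1) * (2 * 2 ^ h) :=
    (Nat.le_succ σ).trans (Nat.le_mul_of_pos_right _ (by positivity))
  have hin : i < n := him.trans hm
  have ha := hs.word_le m hm
  have ha' := hs.word_pos m hm
  have hb := hs.word_le i hin
  have hb' := hs.word_pos i hin
  have hstores : Prog.Fits B (.seq (.store (.add (.var 2) (.var 18)) (.var 11))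
      (.store (.add (.var 2) (.var 10)) (.var 14))) s := by
    simp only [Prog.Fits, Prog.run, Expr.Fits, Expr.eval, hs.env.r2, h10, h11, h14, h18]
    omega
  unfold exchange
  refine Quiet.mono ((Prog.Fits.quiet hstores.1).seq (K' := 240 * (h + 2) + 190) fun s₁ hs₁ => ?_)
    (by simp [Prog.steps, Expr.cost]; omega) fun s' hs' => hs'
  refine Quiet.mono ((hs₁ ▸ Prog.Fits.quiet hstores.2).seq (K' := 240 * (h + 2) + 180)
    fun s₂ hs₂ => ?_) (by simp [Prog.steps, Expr.cost]; omega) fun s' hs' => hs'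
  have hr₂ : s₂.reg = s.reg := by subst hs₂ hs₁; rfl
  have hm₂ : s₂.mem = update (update s.mem (wb + i) (c.word m)) (wb + m) (c.word i) := by
    subst hs₂ hs₁
    simp only [Prog.run, Expr.eval, hs.env.r2, h10, h11, h14, h18]
  have ht₂ : TreesAt s₂.mem (σ + n + (n + 1) + (n + 1)) σ h n (leafEntry n c.word) := by
    rw [hm₂]
    exact (hs.trees.store_of_lt _ (by omega)).store_of_lt _ (by omega)
  have hz : ∀ (s₀ s' : State), (∀ r < 20, s'.reg r = s₀.reg r) →
      Expr.Fits B s' (.const 0) ∧ Expr.eval s' (.const 0) = 0 := by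
    intro s₀ s' _
    simp only [Expr.Fits, Expr.eval, and_true]
    omega
  have hsucc : ∀ {r k : ℕ} {s₀ : State}, r < 20 → s₀.reg r = k → k < n →
      ∀ s' : State, (∀ r < 20, s'.reg r = s₀.reg r) →
      Expr.Fits B s' (.add (.var r) (.const 1)) ∧
        Expr.eval s' (.add (.var r) (.const 1)) = k + 1 := by
    intro r k s₀ hr hk hkn s' h'
    have h1 := h' r hr
    simp only [Expr.Fits, Expr.eval]
    omega
  refine Quiet.mono ((setLeaf_spec hp (hs.env.congr fun r _ => by rw [hr₂]) (rb := 14) (rk := 18)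
    (by norm_num) (hr₂ ▸ h14) (hr₂ ▸ h18) hb' hb hin (Nat.zero_le n) (hz s₂) ht₂).seq
    (K' := 180 * (h + 2) + 140) fun s₃ hs₃ => ?_) (by simp only [Expr.cost]; omega)
    fun s' hs' => hs'
  obtain ⟨hr₃, ht₃, hm₃⟩ := hs₃
  rw [hr₂] at hr₃
  have h14₃ := (hr₃ 14 (by norm_num)).trans h14
  have h10₃ := (hr₃ 10 (by norm_num)).trans h10
  refine Quiet.mono ((setLeaf_spec hp (hs.env.congr fun r _ => hr₃ r (by omega)) (rb := 14)
    (rk := 10) (by norm_num) h14₃ h10₃ hb' hb hm (show m + 1 ≤ n from hm)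
    (hsucc (by norm_num) h10₃ hm) ht₃).seq
    (K' := 120 * (h + 2) + 100) fun s₄ hs₄ => ?_) (by simp only [Expr.cost]; omega)
    fun s' hs' => hs'
  obtain ⟨hr₄, ht₄, hm₄⟩ := hs₄
  have hr₄ : ∀ r < 20, s₄.reg r = s.reg r := fun r hr => (hr₄ r hr).trans (hr₃ r hr)
  have h11₄ := (hr₄ 11 (by norm_num)).trans h11
  have h10₄ := (hr₄ 10 (by norm_num)).trans h10
  refine Quiet.mono ((setLeaf_spec hp (hs.env.congr fun r _ => hr₄ r (by omega)) (rb := 11)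
    (rk := 10) (by norm_num) h11₄ h10₄ ha' ha hm (Nat.zero_le n) (hz s₄) ht₄).seq
    (K' := 60 * (h + 2) + 50) fun s₅ hs₅ => ?_) (by simp only [Expr.cost]; omega)
    fun s' hs' => hs'
  obtain ⟨hr₅, ht₅, hm₅⟩ := hs₅
  have hr₅ : ∀ r < 20, s₅.reg r = s.reg r := fun r hr => (hr₅ r hr).trans (hr₄ r hr)
  have h11₅ := (hr₅ 11 (by norm_num)).trans h11
  have h18₅ := (hr₅ 18 (by norm_num)).trans h18
  refine (setLeaf_spec hp (hs.env.congr fun r _ => hr₅ r (by omega)) (rb := 11)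
    (rk := 18) (by norm_num) h11₅ h18₅ ha' ha hin (show i + 1 ≤ n from hin)
    (hsucc (by norm_num) h18₅ hin) ht₅).mono (by simp only [Expr.cost]; omega) ?_
  rintro s' ⟨hr', ht', hm'⟩
  have hr' : ∀ r < 20, s'.reg r = s.reg r := fun r hr => (hr' r hr).trans (hr₅ r hr)
  have hmem : ∀ a < σ + n + (n + 1) + (n + 1), s'.mem a =
      update (update s.mem (wb + i) (c.word m)) (wb + m) (c.word i) a := fun a h => by
    rw [hm' a h, hm₅ a h, hm₄ a h, hm₃ a h, hm₂]
  have hword : c.word ∘ Equiv.swap i m = update (update c.word i (c.word m)) m (c.word i) := by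
    funext k
    rw [comp_apply, Equiv.swap_apply_def]
    simp only [update_apply]
    split_ifs <;> first | rfl | omega
  have hrange : ∀ k < n, ∃ k' < n, (c.word ∘ Equiv.swap i m) k = c.word k' := by
    intro k hk
    refine ⟨Equiv.swap i m k, ?_, rfl⟩
    rw [Equiv.swap_apply_def]
    split_ifs <;> omega
  refine ⟨⟨hs.env.congr fun r hr => hr' r (by omega), ?_, ?_, ?_, ?_, ?_, ?_, hs.start_le,
    hs.jump_le⟩, hr'⟩
  · intro k hk
    rw [hmem _ (by omega)]
    simp only [hword]
    exact ((hs.word.store_self i _).store_self m _) k hk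
  · obtain ⟨j, hj, hj'⟩ := hs.jump
    refine ⟨j, fun k hk => ?_, hj'⟩
    rw [hmem _ (by omega), update_of_ne (by omega), update_of_ne (by omega), hj k hk]
  · intro k hk
    rw [hmem _ (by omega), update_of_ne (by omega), update_of_ne (by omega), hs.start k hk]
  · convert ht' using 1
    funext b k
    simp only [leafEntry, hword]
    have h3 : m ≠ i := by omega
    by_cases hka : b = c.word m
    · subst hka
      by_cases hk1 : k = i
      · subst hk1
        simp [hin, h3.symm]
      · by_cases hk2 : k = m
        · subst hk2
          simp [h3, hne]
        · simp [hk1, hk2, hne.symm, leafEntry]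
    · by_cases hkb : b = c.word i
      · subst hkb
        by_cases hk1 : k = i
        · subst hk1
          simp [h3.symm, hne, hne.symm]
        · by_cases hk2 : k = m
          · subst hk2
            simp [hm, hne]
          · simp [hk1, hk2, hne, leafEntry]
      · by_cases hk1 : k = i
        · subst hk1
          simp [h3.symm, hka, hkb, leafEntry, Ne.symm hka, Ne.symm hkb]
        · by_cases hk2 : k = m
          · subst hk2
            simp [hka, hkb, leafEntry, Ne.symm hka, Ne.symm hkb]
          · simp [hk1, hk2, hka, hkb, leafEntry]
  · intro k hk
    obtain ⟨k', hk', he⟩ := hrange k hk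
    simp only [he]
    exact hs.word_pos k' hk'
  · intro k hk
    obtain ⟨k', hk', he⟩ := hrange k hk
    simp only [he]
    exact hs.word_le k' hk'

theorem closeLevel_spec {B σ n wb h : ℕ} (hp : Params B σ n wb h) {c : Config} {s : State}
    (hs : Rep σ n wb h c s) {m t : ℕ} (hm : m < n) (ht : t ≤ σ) (h10 : s.reg 10 = m)
    (h12 : s.reg 12 = t) (h15 : s.reg 15 < B) :
    Quiet B closeLevel s 60 fun s' =>
      Rep σ n wb h ⟨c.word, update c.start m (if s.reg 15 = 0 then 0 else t),
        if s.reg 15 = 0 then update (update c.jump m (c.jump (m + 1))) (m + 1) (m + 1)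
          else c.jump⟩ s' ∧ s'.reg = s.reg := by
  have hB := hp.addr_lt
  have hB2 := hp.two_le
  have hwb := hp.wb_le
  have hσ : σ ≤ (σ + 1) * (2 * 2 ^ h) :=
    (Nat.le_succ σ).trans (Nat.le_mul_of_pos_right _ (by positivity))
  -- both branches store into `start`
  have hstart : ∀ (t' : ℕ) (s₁ : State), t' ≤ σ → s₁.reg = s.reg →
      s₁.mem = update s.mem (σ + n + (n + 1) + m) t' →
      Rep σ n wb h ⟨c.word, update c.start m t', c.jump⟩ s₁ := by
    intro t' s₁ ht' hr₁ hm₁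
    refine ⟨hs.env.congr fun r _ => by rw [hr₁], ?_, ?_, ?_, ?_, hs.word_pos, hs.word_le, ?_,
      hs.jump_le⟩
    · rw [hm₁]
      exact hs.word.store_of_ne _ (by omega)
    · obtain ⟨j, hj, hj'⟩ := hs.jump
      rw [hm₁]
      exact ⟨j, hj.store_of_ne _ (by omega), hj'⟩
    · rw [hm₁]
      exact hs.start.store_self m t'
    · rw [hm₁]
      exact hs.trees.store_of_lt _ (by omega)
    · intro k hk
      simp only [update_apply]
      split_ifs
      · exact ht'
      · exact hs.start_le k hk
  by_cases h0 : s.reg 15 = 0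
  · simp only [h0, if_true]
    have h1 : Prog.Fits B (.store (.add (.var 5) (.var 10)) (.const 0)) s := by
      simp only [Prog.Fits, Expr.Fits, Expr.eval, hs.env.r5, h10]
      omega
    unfold closeLevel
    refine Quiet.mono (Quiet.iteFalse h15 h0
      ((Prog.Fits.quiet h1).seq (K' := 50) fun s₁ hs₁ => ?_)) ?_ fun s' hs' => hs'
    swap
    · simp [Prog.steps, Expr.cost]
    have hr₁ : s₁.reg = s.reg := by rw [hs₁]; rfl
    have hrep₁ := hstart 0 s₁ (Nat.zero_le _) hr₁ (by
      rw [hs₁]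
      simp only [Prog.run, Expr.eval, hs.env.r5, h10])
    have h10₁ : s₁.reg 10 = m := by rw [hr₁, h10]
    have hv : Expr.Fits B s₁ (.add (.var 10) (.const 1)) ∧
        Expr.eval s₁ (.add (.var 10) (.const 1)) = m + 1 := by
      simp only [Expr.Fits, Expr.eval, h10₁, and_true]
      omega
    obtain ⟨hjf, hje⟩ := hrep₁.jumpOf hp hv.1 hv.2 hm
    have hjm := hs.jump_le (m + 1) hm
    -- a focus pointer is not 0, so storing it explicitly is not mistaken for the identity
    have hjpos : 1 ≤ c.jump (m + 1) := by
      obtain ⟨j, hj, hj'⟩ := hs.jump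
      rw [← hj' (m + 1) hm]
      rcases Nat.eq_zero_or_pos (j (m + 1)) with h | h
      · rw [h]
        omega
      · omega
    have hr4 : s₁.reg 4 = σ + n := hrep₁.env.r4
    refine (Prog.Fits.quiet (p := .seq (.store (.add (.var 4) (.var 10))
      (jumpOf (.add (.var 10) (.const 1)))) (.store (.add (.var 4) (.add (.var 10) (.const 1)))
      (.const 0))) ?_).mono ?_ ?_
    · refine ⟨⟨?_, hjf⟩, ?_⟩ <;>
        simp only [Prog.Fits, Prog.run, Expr.Fits, Expr.eval, hr4, h10₁] <;> omega
    · simp [Prog.steps, Expr.cost, jumpOf]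
    · rintro s' rfl
      have hmem : (Prog.run (.seq (.store (.add (.var 4) (.var 10))
          (jumpOf (.add (.var 10) (.const 1)))) (.store (.add (.var 4) (.add (.var 10) (.const 1)))
          (.const 0))) s₁).mem = update (update s₁.mem (σ + n + m) (c.jump (m + 1)))
            (σ + n + (m + 1)) 0 := by
        simp only [Prog.run, hje]
        simp only [Expr.eval, hr4, h10₁]
      refine ⟨⟨hs.env.congr fun r _ => congrFun hr₁ r, ?_, ?_, ?_, ?_, hs.word_pos, hs.word_le,
        hrep₁.start_le, ?_⟩, hr₁⟩
      · rw [hmem]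
        exact (hrep₁.word.store_of_ne _ (by omega)).store_of_ne _ (by omega)
      · obtain ⟨j, hj, hj'⟩ := hrep₁.jump
        rw [hmem]
        refine ⟨_, (hj.store_self m _).store_self (m + 1) _, fun k hk => ?_⟩
        by_cases hk1 : k = m + 1
        · subst hk1
          simp
        · by_cases hk2 : k = m
          · subst hk2
            simp [show 1 - c.jump (k + 1) = 0 by omega]
          · simp only [update_of_ne hk1, update_of_ne hk2]
            exact hj' k hk
      · rw [hmem]
        exact (hrep₁.start.store_of_ne _ (by omega)).store_of_ne _ (by omega)
      · rw [hmem]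
        exact (hrep₁.trees.store_of_lt _ (by omega)).store_of_lt _ (by omega)
      · intro k hk
        simp only [update_apply]
        split_ifs
        · omega
        · exact hjm
        · exact hs.jump_le k hk
  · simp only [h0, if_false]
    have hf : Prog.Fits B closeLevel s := by
      refine ⟨h15, fun _ => ?_, fun h => absurd h h0⟩
      simp only [Prog.Fits, Expr.Fits, Expr.eval, hs.env.r5, h10, h12]
      omega
    refine hf.quiet.mono (by simp [closeLevel, Prog.steps, Expr.cost, jumpOf]) ?_
    rintro s' rfl
    have hrun : closeLevel.run s = ⟨s.reg, update s.mem (σ + n + (n + 1) + m) t⟩ := by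
      simp only [closeLevel, Prog.run, Expr.eval, ne_eq, h0, not_false_eq_true, if_true,
        hs.env.r5, h10, h12]
    rw [hrun]
    exact ⟨hstart t _ ht rfl rfl, rfl⟩

/-- The program performs a step of the enumeration. -/
theorem enumStep_of_step {B σ n wb h : ℕ} (hp : Params B σ n wb h) {c c' : Config} {s : State}
    (hs : Rep σ n wb h c s) {i m : ℕ} (hstep : Step n c i m c') :
    Emits B enumStep s (110 * σ + 240 * (h + 2) + 500) (i + 1, m + 1) fun s' =>
      Rep σ n wb h c' s' ∧ s'.reg 8 = s.reg 8 := by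
  obtain ⟨him, hmn, hne⟩ := hstep.swap_spec
  have hB := hp.addr_lt
  have hB2 := hp.two_le
  have hσ : σ ≤ (σ + 1) * (2 * 2 ^ h) :=
    (Nat.le_succ σ).trans (Nat.le_mul_of_pos_right _ (by positivity))
  obtain @⟨f, _, _, b, hf, hj, -, hb, hi⟩ := hstep
  have hfm : f ≤ m := hf.le_of_ne him hne
  have hib : c.word i = b := hi.1
  unfold enumStep
  refine ((findChange_spec hp hs (by omega)).seq_emits
    (K' := 60 * σ + 240 * (h + 2) + 480) fun s₁ ⟨hr₁, hm₁, hf₁⟩ => ?_).mono (by omega)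
    fun _ h => h
  have h9₁ : s₁.reg 9 = f := hf₁.unique hf
  have hs₁ := hs.congr (fun r hr => hr₁ r (by omega)) hm₁
  obtain ⟨hjf, hje⟩ := hs₁.jumpOf hp (r := .var 9) (show s₁.reg 9 < B by omega) h9₁ (by omega)
  rw [hj] at hje
  refine ((Prog.Fits.quiet (p := .assign 10 (jumpOf (.var 9))) hjf).seq_emits
    (K' := 60 * σ + 240 * (h + 2) + 450) fun s₂ hs₂ => ?_).mono ?_ fun _ h => h
  swap
  · simp only [Prog.steps, jumpOf, Expr.cost]
    omega
  have hr₂ : s₂.reg = update s₁.reg 10 m := by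
    rw [hs₂]
    simp only [Prog.run, hje]
  have hm₂ : s₂.mem = s₁.mem := by rw [hs₂]; rfl
  have hrep₂ := hs₁.congr (s' := s₂) (fun r hr => by rw [hr₂, update_of_ne (by omega)]) hm₂
  have h9₂ : s₂.reg 9 = f := by rw [hr₂, update_of_ne (by norm_num), h9₁]
  have h10₂ : s₂.reg 10 = m := by rw [hr₂, update_self]
  have h8₂ : s₂.reg 8 = s.reg 8 := by
    rw [hr₂, update_of_ne (by norm_num), hr₁ 8 (by norm_num)]
  refine (Emits.iteTrue (K := 60 * σ + 240 * (h + 2) + 440) ?_ ?_ ?_).mono ?_ fun _ h => h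
  · simp only [Expr.Fits, hrep₂.env.r1, h10₂]
    omega
  · simp only [Expr.eval, hrep₂.env.r1, h10₂]
    omega
  swap
  · simp only [Expr.cost]
    omega
  refine ((openLevel_spec hp hrep₂ (hfm.trans hmn.le) hmn h9₂ h10₂).seq_emits
    (K' := 60 * σ + 240 * (h + 2) + 410) fun s₃ hs₃ => ?_).mono (by omega) fun _ h => h
  obtain ⟨hrep₃, hr₃, h11₃, h12₃, h13₃⟩ := hs₃
  have h10₃ : s₃.reg 10 = m := (hr₃ 10 (by norm_num)).trans h10₂
  refine ((chooseNext_spec hp hrep₃ hmn h10₃ h12₃ h13₃ ⟨b, hb.1⟩).seq_emits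
    (K' := 240 * (h + 2) + 390) fun s₄ hs₄ => ?_).mono (by omega) fun _ h => h
  obtain ⟨hr₄, hm₄, hb₄, h15₄, h15σ⟩ := hs₄
  have h14₄ : s₄.reg 14 = b := hb₄.unique hb
  rw [h14₄] at h15₄
  have hrep₄ := hrep₃.congr (s' := s₄) (fun r hr => hr₄ r (by omega)) hm₄
  have hb1 := hs.word_pos i (by omega)
  have hbσ := hs.word_le i (by omega)
  rw [hib] at hb1 hbσ
  obtain ⟨hfit, hroot⟩ := hrep₄.rootOf hp h14₄ hb1 hbσ
  have hroot : (rootOf 14).eval s₄ = i + 1 := by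
    obtain ⟨-, h0⟩ | ⟨i', -, hx, hi'⟩ := hroot
    · exact absurd hib (h0 i (by omega))
    · have : i' = i := le_antisymm (hi'.2 ⟨by omega, hib⟩) (hi.2 hi'.1.2)
      rw [hx, this]
  have h18 : (Expr.sub (rootOf 14) (.const 1)).eval s₄ = i := by
    simp only [Expr.eval, hroot]
    omega
  refine ((Prog.Fits.quiet (p := .assign 18 (.sub (rootOf 14) (.const 1)))
    ⟨hfit, show 1 < B by omega⟩).seq_emits (K' := 240 * (h + 2) + 370)
    fun s₅ hs₅ => ?_).mono ?_ fun _ h => h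
  swap
  · simp only [Prog.steps, rootOf, Expr.cost]
    omega
  have hr₅ : s₅.reg = update s₄.reg 18 i := by
    rw [hs₅]
    simp only [Prog.run, h18]
  have hm₅ : s₅.mem = s₄.mem := by rw [hs₅]; rfl
  have hlow₅ : ∀ r < 18, s₅.reg r = s₄.reg r := fun r hr => by rw [hr₅, update_of_ne (by omega)]
  have hrep₅ := hrep₄.congr (s' := s₅) (fun r hr => hlow₅ r (by omega)) hm₅
  have h18₅ : s₅.reg 18 = i := by rw [hr₅, update_self]
  have h10₅ : s₅.reg 10 = m := by rw [hlow₅ 10 (by norm_num), hr₄ 10 (by norm_num), h10₃]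
  have h11₅ : s₅.reg 11 = c.word m := by rw [hlow₅ 11 (by norm_num), hr₄ 11 (by norm_num), h11₃]
  have h12₅ : s₅.reg 12 = startSym c.word (c.start m) m := by
    rw [hlow₅ 12 (by norm_num), hr₄ 12 (by norm_num), h12₃]
  have h14₅ : s₅.reg 14 = c.word i := by rw [hlow₅ 14 (by norm_num), h14₄, hib]
  have hout := Emits.out (B := B) (s := s₅) (a := .add (.var 18) (.const 1))
    (b := .add (.var 10) (.const 1)) (by simp only [Expr.Fits, Expr.eval, h18₅]; omega)
    (by simp only [Expr.Fits, Expr.eval, h10₅]; omega)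
  have hval : ((Expr.add (.var 18) (.const 1)).eval s₅, (Expr.add (.var 10) (.const 1)).eval s₅) =
      (i + 1, m + 1) := by
    simp only [Expr.eval, h18₅, h10₅]
  rw [hval] at hout
  refine (hout.seq (K' := 240 * (h + 2) + 360) fun s₆ hs₆ => ?_).mono ?_ fun _ h => h
  swap
  · simp only [Expr.cost]
    omega
  subst hs₆
  refine ((exchange_spec hp hrep₅ him hmn hne h10₅ h18₅ h11₅ h14₅).seq (K' := 60)
    fun s₇ hs₇ => ?_).mono (by omega) fun _ h => h
  obtain ⟨hrep₇, hr₇⟩ := hs₇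
  have hst : startSym c.word (c.start m) m ≤ σ := by
    unfold startSym
    split_ifs
    · exact hs.word_le m hmn
    · exact hs.start_le m hmn
  have h15₇ : s₇.reg 15 = s₄.reg 15 := by
    rw [hr₇ 15 (by norm_num), hlow₅ 15 (by norm_num)]
  refine (closeLevel_spec hp hrep₇ hmn hst ((hr₇ 10 (by norm_num)).trans h10₅)
    ((hr₇ 12 (by norm_num)).trans h12₅) (by omega)).mono le_rfl ?_
  rintro s' ⟨hrep', hr'⟩
  have hcond : s₇.reg 15 = 0 ↔ cand c.word (c.start m) m = {b} := by rw [h15₇, h15₄]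
  refine ⟨?_, ?_⟩
  · convert hrep' using 1
    simp only [Config.advance, hcond, update_of_ne (show m + 1 ≠ f by omega)]
  · rw [hr', hr₇ 8 (by norm_num), hlow₅ 8 (by norm_num), hr₄ 8 (by norm_num),
      hr₃ 8 (by norm_num), h8₂]

/-- At the end of the enumeration the program clears register 8. -/
theorem enumStep_of_end {B σ n wb h : ℕ} (hp : Params B σ n wb h) {c : Config} {s : State}
    (hs : Rep σ n wb h c s) (hn : 1 ≤ n) {f : ℕ} (hf : FirstChange n c.word f)
    (hj : c.jump f = n) :
    Quiet B enumStep s (110 * σ + 240 * (h + 2) + 500) fun s' => s'.reg 8 = 0 := by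
  have hB := hp.addr_lt
  unfold enumStep
  refine ((findChange_spec hp hs hn).seq
    (K' := 60 * σ + 240 * (h + 2) + 480) fun s₁ ⟨hr₁, hm₁, hf₁⟩ => ?_).mono (by omega) fun _ h => h
  have h9₁ : s₁.reg 9 = f := hf₁.unique hf
  have hs₁ := hs.congr (fun r hr => hr₁ r (by omega)) hm₁
  have hfn := hf.le
  obtain ⟨hjf, hje⟩ := hs₁.jumpOf hp (r := .var 9) (show s₁.reg 9 < B by omega) h9₁ hfn
  rw [hj] at hje
  refine ((Prog.Fits.quiet (p := .assign 10 (jumpOf (.var 9))) hjf).seq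
    (K' := 450) fun s₂ hs₂ => ?_).mono ?_ fun _ h => h
  swap
  · simp only [Prog.steps, jumpOf, Expr.cost]
    omega
  have hr₂ : s₂.reg = update s₁.reg 10 n := by
    rw [hs₂]
    simp only [Prog.run, hje]
  have h10₂ : s₂.reg 10 = n := by rw [hr₂, update_self]
  have h1₂ : s₂.reg 1 = n := by rw [hr₂, update_of_ne (by norm_num), hs₁.env.r1]
  have hz : Prog.Fits B (.assign 8 (.const 0)) s₂ := by
    simp only [Prog.Fits, Expr.Fits]
    omega
  refine (Quiet.iteFalse (by simp only [Expr.Fits, h1₂, h10₂]; omega)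
    (by simp only [Expr.eval, h1₂, h10₂]; omega) hz.quiet).mono ?_ ?_
  · simp only [Prog.steps, Expr.cost]
    omega
  · rintro s' rfl
    simp [Prog.run, Expr.eval]

/-- The enumeration, as long as register 8 is not cleared. -/
def enumLoop : Prog := .loop (.var 8) enumStep

/-- The steps that follow the output of one step and those that precede the output of the next one
add up, whence the quiet prefix `quiet a` in the statement about the delay. -/
theorem enumLoop_spec {B σ n wb h : ℕ} (hp : Params B σ n wb h) (hn : 1 ≤ n) {c c' : Config}
    {l : List (ℕ × ℕ)} (hl : Steps n c l c') {f : ℕ} (hf : FirstChange n c'.word f)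
    (hj : c'.jump f = n) : ∀ {s : State}, Rep σ n wb h c s → s.reg 8 ≠ 0 → s.reg 8 < B →
    ∃ (t : Trace) (s' : State), Exec B enumLoop s t s' ∧
      outputs t = l.map (fun e => (e.1 + 1, e.2 + 1)) ∧
      ∀ a ≤ 110 * σ + 240 * (h + 2) + 500,
        DelayLE (quiet a ++ t) (2 * (110 * σ + 240 * (h + 2) + 500) + 4) := by
  have hB := hp.two_le
  induction hl with
  | nil c =>
    intro s hs h8 h8'
    obtain ⟨k, s', hk, he, h0⟩ := enumStep_of_end hp hs hn hf hj
    have hdone : Exec B enumLoop s' (quiet 2) s' :=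
      .loopDone (show s'.reg 8 < B by omega) h0
    refine ⟨_, s', .loopStep (e := .var 8) h8' h8 he hdone, ?_, fun a ha => ?_⟩
    · rw [quiet_append, quiet_append, outputs_quiet]
      rfl
    · rw [quiet_append, quiet_append, quiet_append]
      refine delayLE_quiet ?_
      simp only [Expr.cost]
      omega
  | cons h hl ih =>
    intro s hs h8 h8'
    obtain ⟨k, k', s', hk, hk', he, hs', h8s⟩ := enumStep_of_step hp hs h
    obtain ⟨t, s'', het, hto, htd⟩ := ih hf hj hs' (h8s ▸ h8) (h8s ▸ h8')
    refine ⟨_, s'', .loopStep (e := .var 8) h8' h8 he het, ?_, fun a ha => ?_⟩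
    · rw [outputs_append, outputs_append, outputs_append, outputs_quiet, outputs_quiet,
        outputs_some_cons, outputs_quiet, hto]
      rfl
    · rw [List.append_assoc, ← List.append_assoc (quiet a), List.append_assoc (quiet k),
        ← List.append_assoc, quiet_append, quiet_append, List.cons_append]
      refine (htd k' hk').quiet_append_some _ ?_
      simp only [Expr.cost]
      omega

/-! ### Preprocessing -/

/-- Compute the parameters from the size of the alphabet (register 0), the length of the word
(register 1) and its address (register 2). -/
def setup : Prog :=
  .seq (.assign 3 (.const 1))
  (.seq (.loop (.sub (.var 1) (.var 3)) (.assign 3 (.add (.var 3) (.var 3))))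
  (.seq (.assign 4 (.add (.var 0) (.var 1)))
  (.seq (.assign 5 (.add (.var 4) (.add (.var 1) (.const 1))))
  (.seq (.assign 6 (.add (.var 5) (.add (.var 1) (.const 1))))
  (.seq (.assign 7 (.mul (.const 2) (.var 3)))
    (.assign 9 (.const 0)))))))

/-- Write out the word and build the trees. -/
def readWord : Prog :=
  .loop (.sub (.var 1) (.var 9))
    (.seq (.assign 11 (.load (.add (.var 2) (.var 9))))
    (.seq (.out (.add (.var 9) (.const 1)) (.var 11))
    (.seq (setLeaf (.var 11) (.var 9) (.add (.var 9) (.const 1)))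
      (.assign 9 (.add (.var 9) (.const 1))))))

/-- The preprocessing phase for a word in memory. For a word of length at most 1 the enumeration is
switched off. -/
def preprocess : Prog :=
  .seq setup (.seq readWord (.assign 8 (.sub (.var 1) (.const 1))))

/-- The state `s` holds the word `w` of length `n` over the symbols `1, …, σ` at address `wb`, and
the memory from `σ + n` on is empty. -/
structure Start (σ n wb : ℕ) (w : ℕ → ℕ) (s : State) : Prop where
  r0 : s.reg 0 = σ
  r1 : s.reg 1 = n
  r2 : s.reg 2 = wb
  word : ArrAt s.mem wb n w
  empty : ∀ a, σ + n ≤ a → s.mem a = 0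
  word_pos : ∀ k < n, 1 ≤ w k
  word_le : ∀ k < n, w k ≤ σ

theorem setup_spec {B σ n wb : ℕ} (hp : Params B σ n wb (Nat.clog 2 n)) {w : ℕ → ℕ} {s : State}
    (hs : Start σ n wb w s) :
    Quiet B setup s (9 * Nat.clog 2 n + 50) fun s' =>
      Env σ n wb (Nat.clog 2 n) s' ∧ s'.reg 9 = 0 ∧ s'.mem = s.mem := by
  set h := Nat.clog 2 n with hh
  have hB := hp.addr_lt
  have hB2 := hp.two_le
  have hσ : 2 * 2 ^ h ≤ (σ + 1) * (2 * 2 ^ h) := Nat.le_mul_of_pos_left _ (by omega)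
  let I : ℕ → State → Prop := fun j s' =>
    j ≤ h ∧ s'.reg 0 = σ ∧ s'.reg 1 = n ∧ s'.reg 2 = wb ∧ s'.reg 3 = 2 ^ (h - j) ∧ s'.mem = s.mem
  have hloop := Quiet.loop (B := B) (K := 4) (e := .sub (.var 1) (.var 3))
    (p := .assign 3 (.add (.var 3) (.var 3))) I
    (by
      rintro s' ⟨-, -, h1, -, h3, -⟩
      rw [Nat.sub_zero] at h3
      have := hp.n_le
      simp only [Expr.Fits, Expr.eval, h1, h3]
      omega)
    (by
      rintro j s' ⟨hj, h0, h1, h2, h3, hm⟩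
      have hlt : 2 ^ (h - (j + 1)) < n := by
        rw [← Nat.lt_clog_iff_pow_lt (by norm_num)]
        omega
      have e2 : 2 ^ (h - j) = 2 ^ (h - (j + 1)) + 2 ^ (h - (j + 1)) := by
        rw [show h - j = h - (j + 1) + 1 by omega]
        ring
      have hle : 2 ^ (h - j) ≤ 2 ^ h := Nat.pow_le_pow_right (by norm_num) (by omega)
      refine ⟨?_, ?_, ?_⟩
      · simp only [Expr.Fits, h1, h3]
        omega
      · simp only [Expr.eval, h1, h3]
        omega
      · refine (Prog.Fits.quiet ?_).mono (by simp [Prog.steps, Expr.cost]) ?_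
        · simp only [Prog.Fits, Expr.Fits, Expr.eval, h3]
          omega
        · rintro s'' rfl
          simp only [I, Prog.run, Expr.eval, h3, ne_eq, OfNat.zero_ne_ofNat, OfNat.one_ne_ofNat,
            Nat.reduceEqDiff, not_false_eq_true, update_of_ne, update_self, h0, h1, h2]
          exact ⟨by omega, trivial, trivial, trivial, e2.symm, hm⟩)
  have hpow : 1 ≤ 2 ^ h := Nat.one_le_two_pow
  unfold setup
  have h1 : Prog.Fits B (.assign 3 (.const 1)) s := by
    simp only [Prog.Fits, Expr.Fits]
    omega
  refine Quiet.mono (h1.quiet.seq fun s₁ hs₁ => (hloop h s₁ ?_).seq (K' := 40)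
    fun s₂ ⟨_, h0, h1, h2, h3, hm⟩ => ?_) ?_ fun _ h => h
  · subst hs₁
    simp only [I, Prog.run, Expr.eval, ne_eq, OfNat.zero_ne_ofNat, OfNat.one_ne_ofNat,
      Nat.reduceEqDiff, not_false_eq_true, update_of_ne, update_self, hs.r0, hs.r1, hs.r2,
      Nat.sub_self, pow_zero, le_refl, and_self]
  · rw [Nat.sub_zero] at h3
    refine (Prog.Fits.quiet ?_).mono (by simp [Prog.steps, Expr.cost]) ?_
    · simp only [Prog.Fits, Prog.run, Expr.Fits, Expr.eval, ne_eq,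
        OfNat.one_ne_ofNat, Nat.reduceEqDiff, not_false_eq_true, update_of_ne, update_self,
        h0, h1, h3]
      omega
    · rintro s' rfl
      refine ⟨⟨?_, ?_, ?_, ?_, ?_, ?_, ?_, ?_⟩, ?_, hm⟩ <;>
      simp only [Prog.run, Expr.eval, ne_eq, OfNat.zero_ne_ofNat,
        OfNat.one_ne_ofNat, Nat.reduceEqDiff, not_false_eq_true, update_of_ne, update_self,
        h0, h1, h2, h3]
  · simp only [Prog.steps, Expr.cost]
    omega

theorem tree_zero (h n : ℕ) : Tree h n (fun _ => 0) (fun _ => 0) := by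
  constructor <;> simp

theorem readWord_spec {B σ n wb h : ℕ} (hp : Params B σ n wb h) {w : ℕ → ℕ} {s : State}
    (hs : Env σ n wb h s) (h9 : s.reg 9 = 0) (hword : ArrAt s.mem wb n w)
    (hempty : ∀ a, σ + n ≤ a → s.mem a = 0) (hpos : ∀ k < n, 1 ≤ w k) (hle : ∀ k < n, w k ≤ σ) :
    Runs B readWord s (n * (120 * (h + 2) + 200) + 4) fun o s' =>
      o = (List.range n).map (fun k => (k + 1, w k)) ∧ Rep σ n wb h ⟨w, fun _ => 0, id⟩ s' := by
  have hB := hp.addr_lt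
  have hB2 := hp.two_le
  have hwb := hp.wb_le
  have hσ : σ ≤ (σ + 1) * (2 * 2 ^ h) :=
    (Nat.le_succ σ).trans (Nat.le_mul_of_pos_right _ (by positivity))
  let I : ℕ → List (ℕ × ℕ) → State → Prop := fun j o s' =>
    ∃ k, j + k = n ∧ s'.reg 9 = k ∧ o = (List.range k).map (fun k => (k + 1, w k)) ∧
      Env σ n wb h s' ∧ (∀ a < σ + n + (n + 1) + (n + 1), s'.mem a = s.mem a) ∧
      TreesAt s'.mem (σ + n + (n + 1) + (n + 1)) σ h n (leafEntry k w)
  have hloop := Runs.loop (B := B) (K := 120 * (h + 2) + 190) (e := .sub (.var 1) (.var 9))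
    (p := .seq (.assign 11 (.load (.add (.var 2) (.var 9))))
    (.seq (.out (.add (.var 9) (.const 1)) (.var 11))
    (.seq (setLeaf (.var 11) (.var 9) (.add (.var 9) (.const 1)))
      (.assign 9 (.add (.var 9) (.const 1)))))) I
    (by
      rintro o s' ⟨k, hk, h9, -, henv, -⟩
      simp only [Expr.Fits, Expr.eval, h9, henv.r1]
      omega)
    (by
      rintro j o s' ⟨k, hk, h9, ho, henv, hmem, htrees⟩
      have hkn : k < n := by omega
      have hload : s'.mem (wb + k) = w k := by rw [hmem _ (by omega), hword k hkn]
      have hpk := hpos k hkn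
      have hlk := hle k hkn
      refine ⟨?_, ?_, ?_⟩
      · simp only [Expr.Fits, h9, henv.r1]
        omega
      · simp only [Expr.eval, h9, henv.r1]
        omega
      have hf₁ : Prog.Fits B (.assign 11 (.load (.add (.var 2) (.var 9)))) s' := by
        simp only [Prog.Fits, Expr.Fits, Expr.eval, henv.r2, h9, hload]
        omega
      refine (Emits.runs (K := 60 * (h + 2) + 80) (x := (k + 1, w k))
        (Q := fun s'' => s''.reg 9 = k + 1 ∧ Env σ n wb h s'' ∧
          (∀ a < σ + n + (n + 1) + (n + 1), s''.mem a = s.mem a) ∧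
          TreesAt s''.mem (σ + n + (n + 1) + (n + 1)) σ h n (leafEntry (k + 1) w))
        ((hf₁.quiet.seq_emits (K' := 60 * (h + 2) + 50) fun s₁ hs₁ => ?_).mono ?_
          fun _ h => h)).mono (by omega) ?_
      · have hr₁ : s₁.reg = update s'.reg 11 (w k) := by
          rw [hs₁]
          simp only [Prog.run, Expr.eval, henv.r2, h9, hload]
        have hm₁ : s₁.mem = s'.mem := by rw [hs₁]; rfl
        have h9₁ : s₁.reg 9 = k := by rw [hr₁, update_of_ne (by norm_num), h9]
        have h11₁ : s₁.reg 11 = w k := by rw [hr₁, update_self]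
        have henv₁ : Env σ n wb h s₁ :=
          henv.congr fun r hr => by rw [hr₁, update_of_ne (by omega)]
        have hout := Emits.out (B := B) (s := s₁) (a := .add (.var 9) (.const 1)) (b := .var 11)
          (by simp only [Expr.Fits, Expr.eval, h9₁]; omega)
          (by simp only [Expr.Fits, h11₁]; omega)
        have hval : ((Expr.add (.var 9) (.const 1)).eval s₁, (Expr.var 11).eval s₁) =
            (k + 1, w k) := by
          simp only [Expr.eval, h9₁, h11₁]
        rw [hval] at hout
        refine (hout.seq (K' := 60 * (h + 2) + 40) fun s₂ hs₂ => ?_).mono ?_ fun _ h => h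
        swap
        · simp only [Expr.cost]
          omega
        subst hs₂
        refine ((setLeaf_spec hp henv₁ (rb := 11) (rk := 9) (by norm_num) h11₁ h9₁ hpk hlk hkn
          (show k + 1 ≤ n from hkn) (fun s₀ h₀ => ?_) (hm₁ ▸ htrees)).seq (K' := 5)
          fun s₃ hs₃ => ?_).mono ?_ fun _ h => h
        · have := (h₀ 9 (by norm_num)).trans h9₁
          simp only [Expr.Fits, Expr.eval, this, and_true]
          omega
        · obtain ⟨hr₃, ht₃, hm₃⟩ := hs₃
          have h9₃ : s₃.reg 9 = k := (hr₃ 9 (by norm_num)).trans h9₁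
          have hf₃ : Prog.Fits B (.assign 9 (.add (.var 9) (.const 1))) s₃ := by
            simp only [Prog.Fits, Expr.Fits, Expr.eval, h9₃]
            omega
          refine hf₃.quiet.mono (by simp [Prog.steps, Expr.cost]) ?_
          rintro s₄ rfl
          refine ⟨?_, ?_, ?_, ?_⟩
          · simp only [Prog.run, Expr.eval, h9₃, update_self]
          · refine henv₁.congr fun r hr => ?_
            simp only [Prog.run]
            rw [update_of_ne (by omega), hr₃ r (by omega)]
          · intro a ha
            simp only [Prog.run]
            rw [hm₃ a ha, hm₁, hmem a ha]
          · have : leafEntry (k + 1) w =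
                update (leafEntry k w) (w k) (update (leafEntry k w (w k)) k (k + 1)) := by
              funext b i
              simp only [leafEntry, update_apply]
              by_cases hb : b = w k
              · subst hb
                by_cases hi : i = k
                · subst hi
                  simp
                · simp only [hi, if_true, if_false, update_apply]
                  congr 1
                  simp only [eq_iff_iff, and_congr_left_iff]
                  omega
              · simp only [hb, if_false]
                congr 1
                simp only [eq_iff_iff]
                constructor
                · rintro ⟨h1, h2⟩
                  have : i ≠ k := by
                    rintro rfl
                    exact hb h2.symm
                  exact ⟨by omega, h2⟩
                · rintro ⟨h1, h2⟩
                  exact ⟨by omega, h2⟩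
            rw [this]
            exact ht₃
        · simp only [Expr.cost]
          omega
      · simp only [Prog.steps, Expr.cost]
        omega
      · rintro o' s'' ⟨rfl, h9', henv', hmem', htrees'⟩
        exact ⟨k + 1, by omega, h9', by rw [ho, List.range_succ, List.map_append]; rfl, henv',
          hmem', htrees'⟩)
  refine (hloop n [] s ⟨0, by omega, h9, rfl, hs, fun _ _ => rfl, ?_⟩).mono ?_ ?_
  · intro b _ _
    have h1 : (fun v => s.mem (σ + n + (n + 1) + (n + 1) + b * (2 * 2 ^ h) + v)) = fun _ => 0 := by
      funext v
      exact hempty _ (by omega)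
    have h2 : leafEntry 0 w b = fun _ => 0 := by
      funext i
      simp [leafEntry]
    rw [h1, h2]
    exact tree_zero h n
  · simp only [Expr.cost]
    exact Nat.add_le_add (Nat.mul_le_mul_left _ (by omega)) (by norm_num)
  · rintro o s' ⟨k, hk, -, ho, henv, hmem, htrees⟩
    obtain rfl : k = n := by omega
    refine ⟨ho, henv, ?_, ⟨fun _ => 0, ?_, ?_⟩, ?_, htrees, hpos, hle, ?_, ?_⟩
    · intro i hi
      rw [hmem _ (by omega), hword i hi]
    · intro i hi
      rw [hmem _ (by omega), hempty _ (by omega)]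
    · intro m _
      simp
    · intro i hi
      rw [hmem _ (by omega), hempty _ (by omega)]
    · intro i _
      exact Nat.zero_le _
    · intro m hm
      exact hm

theorem preprocess_spec {B σ n wb : ℕ} (hp : Params B σ n wb (Nat.clog 2 n)) {w : ℕ → ℕ}
    {s : State} (hs : Start σ n wb w s) :
    Runs B preprocess s (n * (120 * (Nat.clog 2 n + 2) + 200) + 9 * Nat.clog 2 n + 60) fun o s' =>
      o = (List.range n).map (fun k => (k + 1, w k)) ∧
      Rep σ n wb (Nat.clog 2 n) ⟨w, fun _ => 0, id⟩ s' ∧ s'.reg 8 = n - 1 := by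
  have hB := hp.addr_lt
  unfold preprocess
  refine ((setup_spec hp hs).runs.seq (K' := n * (120 * (Nat.clog 2 n + 2) + 200) + 10)
    fun o s₁ ⟨ho, henv, h9, hm⟩ => ?_).mono (by omega) fun _ _ h => h
  subst ho
  refine ((readWord_spec hp henv h9 (hm ▸ hs.word) (hm ▸ hs.empty) hs.word_pos hs.word_le).seq
    (K' := 4) fun o s₂ ⟨ho, hrep⟩ => ?_).mono (by omega) fun _ _ h => h
  subst ho
  have hf : Prog.Fits B (.assign 8 (.sub (.var 1) (.const 1))) s₂ := by
    simp only [Prog.Fits, Expr.Fits, hrep.env.r1]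
    omega
  refine hf.quiet.runs.mono (by simp [Prog.steps, Expr.cost]) ?_
  rintro o s' ⟨rfl, rfl⟩
  refine ⟨by simp, hrep.congr (fun r hr => ?_) rfl, ?_⟩
  · simp only [Prog.run]
    rw [update_of_ne (by omega)]
  · simp only [Prog.run, Expr.eval, hrep.env.r1, update_self]

/-! ### The enumeration from a word in memory -/

theorem clog_le_log_succ (n : ℕ) : Nat.clog 2 n ≤ Nat.log 2 n + 1 :=
  Nat.clog_le_of_le_pow (Nat.lt_pow_succ_log_self (by norm_num) n).le

theorem two_pow_clog_le (n : ℕ) : 2 ^ Nat.clog 2 n ≤ 2 * n + 1 := by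
  rcases Nat.lt_or_ge 1 n with hn | hn
  · have h1 := Nat.pow_pred_clog_lt_self (b := 2) (by norm_num) hn
    have h2 : 0 < Nat.clog 2 n := Nat.clog_pos (by norm_num) hn
    obtain ⟨k, hk⟩ := Nat.exists_eq_succ_of_ne_zero h2.ne'
    rw [hk] at h1 ⊢
    rw [Nat.pred_succ] at h1
    rw [pow_succ]
    omega
  · rw [Nat.clog_of_right_le_one hn]
    simp

/-- The fifth power of `n + σ + 2` leaves room for all addresses. -/
theorem params {σ n wb : ℕ} (hwb : wb ≤ σ) :
    Params ((n + σ + 2) ^ 5) σ n wb (Nat.clog 2 n) := by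
  have h1 := two_pow_clog_le n
  set X := n + σ + 2 with hX
  have hX2 : 2 ≤ X := by omega
  have h8 : 8 * X ^ 2 ≤ X ^ 5 := by
    have : 2 ^ 3 ≤ X ^ 3 := Nat.pow_le_pow_left hX2 3
    calc 8 * X ^ 2 ≤ X ^ 3 * X ^ 2 := Nat.mul_le_mul_right _ this
      _ = X ^ 5 := by ring
  have h2 : (σ + 1) * (2 * 2 ^ Nat.clog 2 n) ≤ X * (4 * X) :=
    Nat.mul_le_mul (by omega) (by omega)
  have h3 : X * 2 ≤ X * X := Nat.mul_le_mul_left _ hX2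
  refine ⟨Nat.le_pow_clog (by norm_num) n, hwb, ?_, ?_⟩
  · nlinarith
  · nlinarith

theorem spell_eq {σ n : ℕ} (w : Fin n → Fin σ) :
    spell w = (List.range n).map fun k => (k + 1, extWord w k) := by
  refine List.ext_getElem (by simp [spell]) fun k h1 h2 => ?_
  simp only [spell, List.length_ofFn] at h1
  simp [spell, extWord, h1]

theorem time_bound {n K : ℕ} (hK : K ≤ 100 * n + 100) :
    K + (n * (120 * (Nat.clog 2 n + 2) + 200) + 9 * Nat.clog 2 n + 60) ≤
      2000 * (n * Nat.log 2 n + 1) := by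
  rcases Nat.lt_or_ge 1 n with hn | hn
  · have h1 : 1 ≤ Nat.log 2 n := Nat.log_pos (by norm_num) hn
    have h2 := clog_le_log_succ n
    have h3 : n * 1 ≤ n * Nat.log 2 n := Nat.mul_le_mul_left n h1
    have h4 : 1 * Nat.log 2 n ≤ n * Nat.log 2 n := Nat.mul_le_mul_right _ hn.le
    have h5 : n * (120 * (Nat.clog 2 n + 2) + 200) ≤ n * (120 * (Nat.log 2 n + 1 + 2) + 200) :=
      Nat.mul_le_mul_left n (by omega)
    have h6 : n * (120 * (Nat.log 2 n + 1 + 2) + 200) = 120 * (n * Nat.log 2 n) + 560 * n := by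
      ring
    omega
  · rw [Nat.clog_of_right_le_one hn]
    omega

theorem delay_bound {σ n : ℕ} (hn : 2 ≤ n) (hσ : 1 ≤ σ) :
    2 * (110 * σ + 240 * (Nat.clog 2 n + 2) + 500) + 4 ≤ 4000 * (σ * Nat.log 2 n + 1) := by
  have h1 : 1 ≤ Nat.log 2 n := Nat.log_pos (by norm_num) hn
  have h2 := clog_le_log_succ n
  have h3 : σ * 1 ≤ σ * Nat.log 2 n := Nat.mul_le_mul_left σ h1
  have h4 : 1 * Nat.log 2 n ≤ σ * Nat.log 2 n := Nat.mul_le_mul_right _ hσ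
  omega

/-- If `p₀` brings the word `w` into memory, then continuing with the preprocessing and the
enumeration solves the enumeration task from `w`. -/
theorem enumeratesFrom_of_start {σ n wb K : ℕ} {P : Fin σ → ℕ} {p₀ : Prog} {s : State}
    (w : ParikhWord n P) (hwb : wb ≤ σ) (hK : K ≤ 100 * n + 100)
    (hp₀ : Quiet ((n + σ + 2) ^ 5) p₀ s K (Start σ n wb (extWord w.1))) :
    EnumeratesFrom (.seq (.seq p₀ preprocess) enumLoop) ((n + σ + 2) ^ 5)
      (4000 * (n * Nat.log 2 n + 1)) (4000 * (σ * Nat.log 2 n + 1)) s w := by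
  have hp := params (n := n) hwb
  obtain ⟨pre, s₁, hlen, hpre, ho, hrep, h8⟩ := hp₀.runs.seq (q := preprocess)
    (Q := fun o s' => o = spell w.1 ∧
      Rep σ n wb (Nat.clog 2 n) ⟨extWord w.1, fun _ => 0, id⟩ s' ∧ s'.reg 8 = n - 1)
    fun o s' ⟨ho, hs'⟩ => (preprocess_spec hp hs').mono le_rfl fun o' s'' h => by
      rw [ho, List.nil_append, spell_eq]
      exact h
  have htime := hlen.trans (time_bound hK)
  have hB := hp.addr_lt
  rcases Nat.lt_or_ge 1 n with hn | hn
  · obtain ⟨l, c', f, hl, hf, hj, v, q, hq, hrec⟩ := exists_hamiltonian hn.le w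
    obtain ⟨t, s₂, het, hto, htd⟩ := enumLoop_spec hp hn.le hl hf hj hrep (by omega) (by omega)
    have hσ : 1 ≤ σ := by
      have := (w.1 ⟨0, by omega⟩).2
      omega
    refine ⟨pre, t, s₂, hpre.seq het, ho, by omega, ⟨v, q, hq, hto ▸ hrec⟩, ?_⟩
    intro q hq hn'
    exact (htd 0 (Nat.zero_le _) q hq hn').trans (delay_bound hn hσ)
  · obtain ⟨v, q, hq, hrec⟩ := exists_hamiltonian_of_le_one hn w
    have h80 : s₁.reg 8 = 0 := by omega
    have hdone : Exec ((n + σ + 2) ^ 5) enumLoop s₁ (quiet 2) s₁ :=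
      .loopDone (e := .var 8) (show s₁.reg 8 < _ by omega) h80
    exact ⟨pre, quiet 2, s₁, hpre.seq hdone, ho, by omega, ⟨v, q, hq, hrec⟩,
      delayLE_quiet (by omega)⟩

/-! ### The sorted word with a given Parikh vector -/

/-- Write the sorted word with the Parikh vector at the addresses `0, …, σ - 1` behind that vector,
and its length into register 1. -/
def expand : Prog :=
  .seq (.assign 2 (.var 0))
    (.loop (.sub (.var 0) (.var 9))
      (.ite (.load (.var 9))
        (.seq (.store (.add (.var 2) (.var 1)) (.add (.var 9) (.const 1)))
        (.seq (.store (.var 9) (.sub (.load (.var 9)) (.const 1)))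
          (.assign 1 (.add (.var 1) (.const 1)))))
        (.assign 9 (.add (.var 9) (.const 1)))))

theorem expand_spec {σ n B : ℕ} {P : Fin σ → ℕ} (hP : ∑ a, P a = n) (hB : σ + n + 2 < B) :
    Quiet B expand (parikhInput P) (30 * (σ + n) + 10) fun s =>
      ∃ w : ParikhWord n P, Start σ n σ (extWord w.1) s := by
  set P' : ℕ → ℕ := (parikhInput P).mem with hP'
  have hP'fin : ∀ a : Fin σ, P' a.1 = P a := fun a => by simp [hP', parikhInput]
  have hsum : ∑ b ∈ Finset.range σ, P' b = n := by
    rw [← hP, ← Fin.sum_univ_eq_sum_range]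
    exact Finset.sum_congr rfl fun a _ => hP'fin a
  -- `a` is the current symbol, `k` the number of positions already written
  let I : ℕ → State → Prop := fun i s => ∃ a k, s.reg 0 = σ ∧ s.reg 1 = k ∧ s.reg 2 = σ ∧
    s.reg 9 = a ∧ a ≤ σ ∧ i = (σ - a) + (n - k) ∧ k + ∑ b ∈ Finset.range σ, s.mem b = n ∧
    (∀ b < a, s.mem b = 0) ∧ (∀ c, σ + k ≤ c → s.mem c = 0) ∧
    (∀ i < k, 1 ≤ s.mem (σ + i) ∧ s.mem (σ + i) ≤ σ) ∧
    ∀ b < σ, ((Finset.range k).filter fun i => s.mem (σ + i) = b + 1).card + s.mem b = P' b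
  have hloop := Quiet.loop (B := B) (K := 25) (e := .sub (.var 0) (.var 9))
    (p := .ite (.load (.var 9))
        (.seq (.store (.add (.var 2) (.var 1)) (.add (.var 9) (.const 1)))
        (.seq (.store (.var 9) (.sub (.load (.var 9)) (.const 1)))
          (.assign 1 (.add (.var 1) (.const 1)))))
        (.assign 9 (.add (.var 9) (.const 1)))) I
    (by
      rintro s ⟨a, k, h0, h1, h2, h9, ha, hi, hk, hz, he, hw, hc⟩
      simp only [Expr.Fits, Expr.eval, h0, h9]
      omega)
    (by
      rintro i s ⟨a, k, h0, h1, h2, h9, ha, hi, hk, hz, he, hw, hc⟩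
      have haσ : a < σ := by
        by_contra hlt
        have : ∑ b ∈ Finset.range σ, s.mem b = 0 :=
          Finset.sum_eq_zero fun b hb => hz b (by rw [Finset.mem_range] at hb; omega)
        omega
      have hle : s.mem a ≤ ∑ b ∈ Finset.range σ, s.mem b :=
        Finset.single_le_sum (f := s.mem) (fun _ _ => Nat.zero_le _) (Finset.mem_range.2 haσ)
      have hne : σ + k ≠ a := by omega
      refine ⟨?_, ?_, ?_⟩
      · simp only [Expr.Fits, h0, h9]
        omega
      · simp only [Expr.eval, h0, h9]
        omega
      refine (Prog.Fits.quiet ?_).mono (by simp [Prog.steps, Expr.cost]) ?_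
      · simp only [Prog.Fits, Prog.run, Expr.Fits, Expr.eval, h1, h2, h9,
          update_of_ne hne.symm]
        omega
      · rintro s' rfl
        by_cases h : s.mem a = 0
        · simp only [Prog.run, Expr.eval, h9, h, ne_eq, not_true_eq_false, if_false]
          refine ⟨a + 1, k, ?_⟩
          simp only [ne_eq, OfNat.zero_ne_ofNat, OfNat.one_ne_ofNat, Nat.reduceEqDiff,
            not_false_eq_true, update_of_ne, update_self]
          refine ⟨h0, h1, h2, trivial, haσ, by omega, hk, fun b hb => ?_, he, hw, hc⟩
          by_cases hba : b = a
          · rw [hba, h]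
          · exact hz b (by omega)
        · simp only [Prog.run, Expr.eval, h1, h2, h9, h, ne_eq, not_false_eq_true, if_true,
            update_of_ne hne.symm]
          refine ⟨a, k + 1, ?_⟩
          simp only [ne_eq, zero_ne_one, OfNat.ofNat_ne_one,
            not_false_eq_true, update_of_ne, update_self, h0, h2, h9, true_and]
          set M := update (update s.mem (σ + k) (a + 1)) a (s.mem a - 1) with hM
          have hMa : M a = s.mem a - 1 := update_self ..
          have hMk : M (σ + k) = a + 1 := by rw [hM, update_of_ne hne, update_self]
          have hMo : ∀ c, c ≠ a → c ≠ σ + k → M c = s.mem c := fun c h1 h2 => by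
            rw [hM, update_of_ne h1, update_of_ne h2]
          have hsumM : ∑ b ∈ Finset.range σ, M b + 1 = ∑ b ∈ Finset.range σ, s.mem b := by
            rw [← Finset.add_sum_erase _ M (Finset.mem_range.2 haσ),
              ← Finset.add_sum_erase _ s.mem (Finset.mem_range.2 haσ), hMa]
            have : ∑ b ∈ (Finset.range σ).erase a, M b =
                ∑ b ∈ (Finset.range σ).erase a, s.mem b := by
              refine Finset.sum_congr rfl fun b hb => ?_
              rw [Finset.mem_erase, Finset.mem_range] at hb
              exact hMo b hb.1 (by omega)
            omega
          refine ⟨ha, by omega, by omega, fun b hb => ?_, fun c hc => ?_, fun i hi => ?_,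
            fun b hb => ?_⟩
          · rw [hMo b (by omega) (by omega), hz b hb]
          · rw [hMo c (by omega) (by omega), he c (by omega)]
          · by_cases hik : i = k
            · subst hik
              omega
            · rw [hMo _ (by omega) (by omega)]
              exact hw i (by omega)
          · rw [card_filter_range_succ k (fun i => M (σ + i)) (b + 1)]
            have hf : ((Finset.range k).filter fun i => M (σ + i) = b + 1) =
                (Finset.range k).filter fun i => s.mem (σ + i) = b + 1 := by
              refine Finset.filter_congr fun i hi => ?_
              rw [Finset.mem_range] at hi
              rw [hMo _ (by omega) (by omega)]
            have := hc b hb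
            rw [hf, hMk]
            by_cases hba : b = a
            · subst hba
              rw [hMa, if_pos rfl]
              omega
            · rw [hMo b hba (by omega), if_neg (by omega)]
              omega)
  unfold expand
  have hassign : Prog.Fits B (.assign 2 (.var 0)) (parikhInput P) := by
    simp only [Prog.Fits, Expr.Fits, parikhInput, if_true]
    omega
  refine (hassign.quiet.seq fun s₁ hs₁ => hloop (σ + n) s₁ ?_).mono ?_ ?_
  · subst hs₁
    refine ⟨0, 0, ?_⟩
    simp only [Prog.run, Expr.eval]
    refine ⟨by simp [parikhInput], by simp [parikhInput], by simp [parikhInput],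
      by simp [parikhInput], by omega, by omega, by rw [hsum]; omega, by omega, fun c hc => ?_,
      by omega, fun b _ => ?_⟩
    · simp only [parikhInput]
      rw [dif_neg (by omega)]
    · exact Nat.zero_add _
  · simp only [Prog.steps, Expr.cost]
    omega
  · rintro s ⟨a, k, h0, h1, h2, h9, ha, hi, hk, hz, he, hw, hc⟩
    obtain rfl : a = σ := by omega
    have hs0 : ∑ b ∈ Finset.range a, s.mem b = 0 :=
      Finset.sum_eq_zero fun b hb => hz b (Finset.mem_range.1 hb)
    obtain rfl : k = n := by omega
    let w : Fin k → Fin a := fun i => ⟨s.mem (a + i.1) - 1, by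
      have := hw i.1 i.2
      omega⟩
    have hext : ∀ i < k, extWord w i = s.mem (a + i) := by
      intro i hi
      have := hw i hi
      simp only [extWord, hi, dif_pos, w]
      omega
    have hpar : parikh w = P := by
      funext b
      have h3 := hc b.1 b.2
      rw [hz b.1 b.2, hP'fin, Nat.add_zero] at h3
      rw [← h3]
      have h4 := card_filter_extWord w (b.1 + 1)
      have h5 : ((Finset.range k).filter fun i => extWord w i = b.1 + 1) =
          (Finset.range k).filter fun i => s.mem (a + i) = b.1 + 1 :=
        Finset.filter_congr fun i hi => by rw [hext i (Finset.mem_range.1 hi)]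
      rw [h5] at h4
      rw [h4]
      unfold parikh
      congr 1
      ext i
      simp [Fin.ext_iff]
    refine ⟨⟨w, hpar⟩, h0, h1, h2, fun i hi => (hext i hi).symm, he, fun i hi => ?_, fun i hi => ?_⟩
    · rw [hext i hi]
      exact (hw i hi).1
    · rw [hext i hi]
      exact (hw i hi).2

end SwapGraph

theorem mainTheorem5 :
    (∃ (p : SwapGraph.Prog) (C c : ℕ),
      ∀ (σ n : ℕ) (P : Fin σ → ℕ), ∑ a, P a = n → σ ≤ n →
        ∃ w : SwapGraph.ParikhWord n P,
          SwapGraph.EnumeratesFrom p ((n + σ + 2) ^ c)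
            (C * (n * Nat.log 2 n + 1)) (C * (σ * Nat.log 2 n + 1))
            (SwapGraph.parikhInput P) w) ∧
    (∃ (p : SwapGraph.Prog) (C c : ℕ),
      ∀ (σ n : ℕ) (P : Fin σ → ℕ), ∑ a, P a = n →
        ∀ w : SwapGraph.ParikhWord n P,
          SwapGraph.EnumeratesFrom p ((n + σ + 2) ^ c)
            (C * (n * Nat.log 2 n + 1)) (C * (σ * Nat.log 2 n + 1))
            (SwapGraph.wordInput w.1) w) := by
  open SwapGraph in
  constructor
  · refine ⟨.seq (.seq expand preprocess) enumLoop, 4000, 5, fun σ n P hP hσ => ?_⟩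
    have hp := (params (σ := σ) (n := n) le_rfl).addr_lt
    have hpos : 0 < (σ + 1) * (2 * 2 ^ Nat.clog 2 n) := by positivity
    obtain ⟨k, s, hk, he, w, hw⟩ := expand_spec (B := (n + σ + 2) ^ 5) hP (by omega)
    exact ⟨w, enumeratesFrom_of_start w le_rfl (by omega) ⟨k, s, hk, he, hw⟩⟩
  · refine ⟨.seq (.seq .skip preprocess) enumLoop, 4000, 5, fun σ n P hP w => ?_⟩
    refine enumeratesFrom_of_start (wb := 0) w (Nat.zero_le σ) (K := 1) (by omega)
      ⟨1, _, le_rfl, .skip _, ?_⟩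
    refine ⟨rfl, rfl, rfl, fun k hk => ?_, fun a ha => ?_, fun k hk => ?_, fun k hk => ?_⟩
    · simp [wordInput, extWord]
    · simp only [wordInput]
      rw [dif_neg (by omega)]
    · simp [extWord, hk]
    · simp only [extWord, hk, dif_pos]
      exact (w.1 ⟨k, hk⟩).2
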